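/- Let $d\ge 1$ and let $\Phi$ be the standard normal distribution on $\mathbb{R}^d$, with $Z\sim\Phi$. *Test functions.* For $h:\mathbb{R}^d\to\mathbb{R}$ and $\delta>0$ put $h_\delta^+(x)=\sup\{h(x+y):|y|\le\delta\}$ and $h_\delta^-(x)=\inf\{h(x+y):|y|\le\delta\}$. Let $\mathcal{H}$ be a class of Borel measurable functions $\mathbb{R}^d\to\mathbb{R}$ with $|h|\le 1$ for all $h\in\mathcal{H}$, and let $a\ge 1$ be a constant, such that: (C1) $h_\delta^+,h_\delta^-\in\mathcal{H}$ for all $h\in\mathcal{H}$, $\delta>0$; (C2) $x\mapsto h(Mx+b)$ is in $\mathcal{H}$ for all $h\in\mathcal{H}$, all real $d\times d$ matrices $M$ and all $b\in\mathbb{R}^d$; (C3) $\sup_{h\in\mathcal{H}}\int (h_\delta^+-h_\delta^-)\,d\Phi\le a\delta$ for all $\delta>0$. *The pair.* Let $(W,W')$ be an exchangeable pair of square integrable random vectors in $\mathbb{R}^d$ with $\mathbb{E}W=0$ and $\mathbb{E}WW^t=\Sigma$ positive definite, such that $\mathbb{E}^W(W'-W)=-\Lambda W+R$ for an invertible matrix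 $\Lambda$ and a $\sigma(W)$-measurable random vector $R$. Put $Y=\Sigma^{-1/2}W$, $\Delta=\Sigma^{-1/2}(W'-W)$, $\hat\lambda^{(i)}=\sum_{m=1}^d|(\Sigma^{-1/2}\Lambda^{-1}\Sigma^{1/2})_{m,i}|$ and $$A'=\sum_{i,j}\hat\lambda^{(i)}\sqrt{\operatorname{Var}\mathbb{E}^Y(\Delta_i\Delta_j)},\quad B'=\sum_{i,j,k}\hat\lambda^{(i)}\mathbb{E}|\Delta_i\Delta_j\Delta_k|,\quad C'=\sum_i\hat\lambda^{(i)}\sqrt{\mathbb{E}\big((\Sigma^{-1/2}R)_i\big)^2},$$ and assume that $A'$ and $B'$ are finite. Put $$D'=\frac{A'}2+C'd,\qquad T'=\frac1{a^2}\Big(D'+\sqrt{\tfrac{aB'}2+D'^2}\Big)^2 .$$ *Statement.* There is a constant $\gamma=\gamma(d)>0$, depending only on $d$, such that for every such $\mathcal{H}$, $a$ and every such pair with $T'\le 1$, $$\sup_{h\in\mathcal{H}}|\mathbb{E}h(W)-\mathbb{E}h(\Sigma^{1/2}Z)|\le\gamma^2\Big(-D'\log T'+\frac{B'}{2\sqrt{T'}}+C'+a\sqrt{T'}\Big).$$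 In particular, let $\mathcal{H}$ and $a$ be fixed and let $(W_n,W_n')$, $n\in\mathbb{N}$, be a sequence of such pairs (each with its own probability space and its own $\Sigma_n,\Lambda_n,R_n$) for which $A'_n,B'_n,C'_n$ are all $O(n^{-1/2})$. Then $\sup_{h\in\mathcal{H}}|\mathbb{E}h(W_n)-\mathbb{E}h(\Sigma_n^{1/2}Z)|=O(n^{-1/4})$. -/

import Mathlib

open MeasureTheory ProbabilityTheory Filter Asymptotics
open scoped Matrix MatrixOrder

noncomputable section

namespace ExchPair

/-- `ℝ^d` with the Euclidean norm. -/
abbrev Vec (d : ℕ) : Type := EuclideanSpace ℝ (Fin d)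

/-- Real `d × d` matrices. -/
abbrev Mat (d : ℕ) : Type := Matrix (Fin d) (Fin d) ℝ

/-- The matrix-vector product `M x`. -/
abbrev app {d : ℕ} (M : Mat d) (x : Vec d) : Vec d := Matrix.toEuclideanCLM (𝕜 := ℝ) M x

/-- The standard normal distribution `Φ` on `ℝ^d`. -/
abbrev Phi (d : ℕ) : Measure (Vec d) := stdGaussian (Vec d)

/-- `h_δ^+ (x) = sup {h (x + y) : |y| ≤ δ}`. -/
def upper {d : ℕ} (h : Vec d → ℝ) (δ : ℝ) (x : Vec d) : ℝ :=
  sSup {r | ∃ y : Vec d, ‖y‖ ≤ δ ∧ r = h (x + y)}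

/-- `h_δ^- (x) = inf {h (x + y) : |y| ≤ δ}`. -/
def lower {d : ℕ} (h : Vec d → ℝ) (δ : ℝ) (x : Vec d) : ℝ :=
  sInf {r | ∃ y : Vec d, ‖y‖ ≤ δ ∧ r = h (x + y)}

/-- A class `H` of Borel functions on `ℝ^d`, bounded by `1`, satisfying (C1), (C2), (C3), where
(C3) holds with constant `a ≥ 1`. -/
structure IsTestClass {d : ℕ} (H : Set (Vec d → ℝ)) (a : ℝ) : Prop where
  measurable : ∀ h ∈ H, Measurable h
  bounded : ∀ h ∈ H, ∀ x, |h x| ≤ 1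
  upper_mem : ∀ h ∈ H, ∀ δ : ℝ, 0 < δ → upper h δ ∈ H
  lower_mem : ∀ h ∈ H, ∀ δ : ℝ, 0 < δ → lower h δ ∈ H
  affine_mem : ∀ h ∈ H, ∀ (A : Mat d) (b : Vec d), (fun x => h (app A x + b)) ∈ H
  one_le : 1 ≤ a
  oscillation : ∀ δ : ℝ, 0 < δ → ∀ h ∈ H, ∫ x, (upper h δ x - lower h δ x) ∂(Phi d) ≤ a * δ

/-- The σ-algebra `σ(X)` generated by a random vector. -/
abbrev sig {d : ℕ} {Ω : Type*} (X : Ω → Vec d) : MeasurableSpace Ω :=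
  MeasurableSpace.comap X inferInstance

/-- `(W, W')` is an exchangeable pair of random vectors with mean `0` and positive definite
covariance matrix `S`, satisfying `E^W (W' - W) = -Λ W + R` for an invertible matrix `Λ` and a
`σ(W)`-measurable random vector `R`. -/
structure IsSteinPair {d : ℕ} {Ω : Type*} [MeasurableSpace Ω] (μ : Measure Ω)
    (W W' R : Ω → Vec d) (S L : Mat d) : Prop where
  measurable_left : Measurable W
  measurable_right : Measurable W'
  exchangeable : μ.map (fun ω => (W ω, W' ω)) = μ.map (fun ω => (W' ω, W ω))
  memLp : MemLp W 2 μ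
  mean : ∀ i, ∫ ω, W ω i ∂μ = 0
  cov : ∀ i j, ∫ ω, W ω i * W ω j ∂μ = S i j
  posDef : S.PosDef
  invertible : IsUnit L
  remainder_measurable : Measurable[sig W] R
  regression : ∀ i, μ[fun ω => W' ω i - W ω i | sig W] =ᵐ[μ] fun ω => -(app L (W ω) i) + R ω i

/-- `S^{-1/2} X`, with `S^{1/2}` the nonnegative definite square root of `S`. -/
def standardize {d : ℕ} {Ω : Type*} (S : Mat d) (X : Ω → Vec d) (ω : Ω) : Vec d :=
  app (CFC.sqrt S)⁻¹ (X ω)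

/-- The `i`-th component `∑_k (S^{-1/2})_{i,k} (W'_k - W_k)` of `S^{-1/2} (W' - W)`. -/
def incr {d : ℕ} {Ω : Type*} (S : Mat d) (W W' : Ω → Vec d) (i : Fin d) (ω : Ω) : ℝ :=
  standardize S W' ω i - standardize S W ω i

/-- `E^Y (S^{-1/2}(W' - W))_i (S^{-1/2}(W' - W))_j`, where `Y = S^{-1/2} W`. -/
def condProd {d : ℕ} {Ω : Type*} [MeasurableSpace Ω] (μ : Measure Ω) (S : Mat d)
    (W W' : Ω → Vec d) (i j : Fin d) : Ω → ℝ :=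
  μ[fun ω => incr S W W' i ω * incr S W W' j ω | sig (standardize S W)]

/-- `λ̂^{(i)} = ∑_m |(S^{-1/2} Λ⁻¹ S^{1/2})_{m,i}|`. -/
def lam {d : ℕ} (S L : Mat d) (i : Fin d) : ℝ :=
  ∑ m, |((CFC.sqrt S)⁻¹ * L⁻¹ * CFC.sqrt S) m i|

/-- `A' = ∑_{i,j} λ̂^{(i)} √(Var E^Y (S^{-1/2}(W' - W))_i (S^{-1/2}(W' - W))_j)`. -/
def A' {d : ℕ} {Ω : Type*} [MeasurableSpace Ω] (μ : Measure Ω) (W W' : Ω → Vec d)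
    (S L : Mat d) : ℝ :=
  ∑ i, ∑ j, lam S L i * √(variance (condProd μ S W W' i j) μ)

/-- `B' = ∑_{i,j,k} λ̂^{(i)} E |∏_{l = i,j,k} (S^{-1/2}(W' - W))_l|`. -/
def B' {d : ℕ} {Ω : Type*} [MeasurableSpace Ω] (μ : Measure Ω) (W W' : Ω → Vec d)
    (S L : Mat d) : ℝ :=
  ∑ i, ∑ j, ∑ k, lam S L i * ∫ ω, |incr S W W' i ω * incr S W W' j ω * incr S W W' k ω| ∂μ

/-- `C' = ∑_i λ̂^{(i)} √(E (∑_k (S^{-1/2})_{i,k} R_k)²)`. -/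
def C' {d : ℕ} {Ω : Type*} [MeasurableSpace Ω] (μ : Measure Ω) (R : Ω → Vec d)
    (S L : Mat d) : ℝ :=
  ∑ i, lam S L i * √(∫ ω, (standardize S R ω i) ^ 2 ∂μ)

/-- The variances in `A'` and the third absolute moments in `B'` are finite (so that `A'` and `B'`
are genuine real numbers). The moments in `C'` are finite for every pair as in `IsSteinPair`. -/
structure FiniteTerms {d : ℕ} {Ω : Type*} [MeasurableSpace Ω] (μ : Measure Ω)
    (W W' : Ω → Vec d) (S : Mat d) : Prop where
  variance : ∀ i j, MemLp (condProd μ S W W' i j) 2 μ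
  third : ∀ i j k,
    Integrable (fun ω => incr S W W' i ω * incr S W W' j ω * incr S W W' k ω) μ

/-- `D' = A' / 2 + C' d`. -/
def D' {d : ℕ} {Ω : Type*} [MeasurableSpace Ω] (μ : Measure Ω) (W W' R : Ω → Vec d)
    (S L : Mat d) : ℝ :=
  A' μ W W' S L / 2 + C' μ R S L * d

/-- `T' = a⁻² (D' + √(a B' / 2 + D'²))²`. -/
def T' {d : ℕ} {Ω : Type*} [MeasurableSpace Ω] (μ : Measure Ω) (W W' R : Ω → Vec d)
    (S L : Mat d) (a : ℝ) : ℝ :=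
  1 / a ^ 2 *
    (D' μ W W' R S L + √(a * B' μ W W' S L / 2 + D' μ W W' R S L ^ 2)) ^ 2

/-- `sup_{h ∈ H} |E h(W) - E h(S^{1/2} Z)|` with `Z` standard normal. For a class of functions
bounded by `1` the set is bounded by `2`; for empty `H` the value is `0`. -/
def distance {d : ℕ} {Ω : Type*} [MeasurableSpace Ω] (μ : Measure Ω) (H : Set (Vec d → ℝ))
    (W : Ω → Vec d) (S : Mat d) : ℝ :=
  sSup {r | ∃ h ∈ H, r = |∫ ω, h (W ω) ∂μ - ∫ z, h (app (CFC.sqrt S) z) ∂(Phi d)|}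

end ExchPair

end

/-! ### Gaussian integration by parts and rotation invariance. -/

namespace ExchPair

open scoped RealInnerProductSpace

/-! Let Y = Σ^{-1/2} W with law ν, and let Z be standard normal and independent of Y. By (C2) it is
enough to compare ν with Φ on the class. For smooth compactly supported h with |h| ≤ 1 put F(θ) = E
h(cos θ Y + sin θ Z), so that F(π/2) = ∫ h dΦ. Gaussian integration by parts turns F'(θ) into sin θ
times a Stein expression E ∑_m (∂_m g_m(Y) - Y_m g_m(Y)), where g_m is a Gaussian average of ∂_m h
(`IsSmoothCompact.hasDerivAt_integral_gaussAvg`). No Stein equation has to be solved.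

Exchangeability and the regression property bound this expression by the three error terms, weighted
with bounds on g_m and its first two derivatives (`IsNormalizedPair.abs_integral_stein_le`).
Integration by parts against the normal density bounds the first three derivatives of the average by
constants times s⁻¹, s⁻², s⁻³, with s = sin θ, using only |h| ≤ 1. Hence |F'| is of order D' cot θ +
B' / sin² θ + C', and integration up to π/2 gives -D' log s + B' / s + C'. Since only the sup norm
of h enters, the estimate extends to bounded Borel functions (`abs_integral_sub_le_of_smooth`).

It remains to remove the smoothing. If ν and Φ differ by κ at most on the class and by η after
smoothing, then (C1)-(C3) and a tail bound for Z give a difference of at most O(a s) + κ/3 + 4η/3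
(`IsTestClass.sSup_le_of_smoothed`). With κ the supremum, κ/3 is absorbed on the left. Writing s =
√t, this yields a bound for every t in (0, 1] (`IsSteinPair.distance_le`). The first claim takes t =
T' and the second t = n^{-1/2}. -/

lemma hasDerivAt_gaussianPDFReal_zero_one (x : ℝ) :
    HasDerivAt (gaussianPDFReal 0 1) (-x * gaussianPDFReal 0 1 x) x := by
  have h1 : HasDerivAt (fun y : ℝ => -(y - 0) ^ 2 / (2 * ((1 : NNReal) : ℝ))) (-x) x := by
    have := (((hasDerivAt_id x).sub_const 0).pow 2).neg.div_const (2 * ((1 : NNReal) : ℝ))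
    refine this.congr_deriv ?_
    simp
    ring
  have h2 := (h1.exp).const_mul ((√(2 * Real.pi * ((1 : NNReal) : ℝ)))⁻¹)
  rw [gaussianPDFReal_def]
  refine h2.congr_deriv ?_
  simp only
  ring

lemma integrable_gaussianReal_iff {f : ℝ → ℝ} :
    Integrable f (gaussianReal 0 1) ↔ Integrable (fun x => gaussianPDFReal 0 1 x * f x) := by
  rw [gaussianReal_of_var_ne_zero _ one_ne_zero,
    integrable_withDensity_iff_integrable_smul' (measurable_gaussianPDF 0 1)
      (ae_of_all _ fun x => by simp [gaussianPDF])]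
  simp [toReal_gaussianPDF]

/-- Gaussian integration by parts on the line. -/
lemma integral_mul_gaussianReal_eq {f f' : ℝ → ℝ} (hf : ∀ x, HasDerivAt f (f' x) x)
    (h0 : Integrable f (gaussianReal 0 1)) (h1 : Integrable (fun x => x * f x) (gaussianReal 0 1))
    (h2 : Integrable f' (gaussianReal 0 1)) :
    ∫ x, x * f x ∂(gaussianReal 0 1) = ∫ x, f' x ∂(gaussianReal 0 1) := by
  rw [integral_gaussianReal_eq_integral_smul one_ne_zero,
    integral_gaussianReal_eq_integral_smul one_ne_zero]
  rw [integrable_gaussianReal_iff] at h0 h1 h2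
  have h := integral_mul_deriv_eq_deriv_mul_of_integrable (u := gaussianPDFReal 0 1) (v := f)
    (u' := fun x => -x * gaussianPDFReal 0 1 x) (v' := f')
    (fun x _ => hasDerivAt_gaussianPDFReal_zero_one x) (fun x _ => hf x) h2
    (by
      refine h1.neg.congr (ae_of_all _ fun x => ?_)
      simp only [Pi.neg_apply, Pi.mul_apply]
      ring)
    h0
  simp only [smul_eq_mul]
  rw [h, ← integral_neg]
  congr 1
  ext x
  ring

variable {d : ℕ}

/-- Replacing the `i`-th coordinate of a standard normal vector by an independent standard normal
variable does not change its law. -/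
lemma measurePreserving_resample (i : Fin d) :
    MeasurePreserving (fun p : Vec d × ℝ => p.1 + (p.2 - p.1 i) • EuclideanSpace.single i (1 : ℝ))
      ((Phi d).prod (gaussianReal 0 1)) (Phi d) := by
  have hm : Measurable
      (fun p : Vec d × ℝ => p.1 + (p.2 - p.1 i) • EuclideanSpace.single i (1 : ℝ)) := by
    fun_prop
  refine ⟨hm, ?_⟩
  have := Measure.isProbabilityMeasure_map (μ := (Phi d).prod (gaussianReal 0 1)) hm.aemeasurable
  refine Measure.ext_of_charFun ?_
  ext t
  rw [charFun_apply, integral_map hm.aemeasurable (by fun_prop)]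
  have h : ∀ p : Vec d × ℝ,
      Complex.exp (⟪p.1 + (p.2 - p.1 i) • EuclideanSpace.single i (1 : ℝ), t⟫ * Complex.I) =
      Complex.exp (⟪p.1, t - t i • EuclideanSpace.single i (1 : ℝ)⟫ * Complex.I) *
      Complex.exp (⟪p.2, t i⟫ * Complex.I) := by
    intro p
    rw [← Complex.exp_add, ← add_mul, ← Complex.ofReal_add]
    congr 3
    simp [inner_add_left, inner_sub_right, inner_smul_left, inner_smul_right,
      EuclideanSpace.inner_single_left, EuclideanSpace.inner_single_right]
    ring
  simp_rw [h]
  rw [integral_prod_mul (fun x : Vec d =>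
      Complex.exp (⟪x, t - t i • EuclideanSpace.single i (1 : ℝ)⟫ * Complex.I))
      (fun r : ℝ => Complex.exp (⟪r, t i⟫ * Complex.I)), ← charFun_apply, ← charFun_apply,
    charFun_stdGaussian, charFun_stdGaussian, charFun_gaussianReal, ← Complex.exp_add]
  congr 1
  -- Pythagoras: the two factors of the characteristic function see orthogonal parts of t, so their
  -- exponents add up to -|t|²/2.
  have h2 : ‖t‖ ^ 2 = ‖t - t i • EuclideanSpace.single i (1 : ℝ)‖ ^ 2 + t i ^ 2 := by
    rw [norm_sub_sq_real]
    simp [inner_smul_right, EuclideanSpace.inner_single_right, norm_smul]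
    ring
  have h3 : (‖t‖ : ℂ) ^ 2 =
      (‖t - t i • EuclideanSpace.single i (1 : ℝ)‖ : ℂ) ^ 2 + (t i : ℂ) ^ 2 := by
    exact_mod_cast h2
  rw [h3]
  simp
  ring

/-- Gaussian integration by parts in the direction of the `i`-th coordinate. -/
lemma integral_coord_mul_eq (i : Fin d) {F F' : Vec d → ℝ}
    (hF : ∀ x, HasLineDerivAt ℝ F (F' x) x (EuclideanSpace.single i (1 : ℝ)))
    (h0 : Integrable F (Phi d)) (h1 : Integrable (fun x => x i * F x) (Phi d))
    (h2 : Integrable F' (Phi d)) :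
    ∫ x, x i * F x ∂(Phi d) = ∫ x, F' x ∂(Phi d) := by
  have hp := measurePreserving_resample i
  have key : ∀ {G : Vec d → ℝ}, Integrable G (Phi d) → (∫ x, G x ∂(Phi d) =
      ∫ x : Vec d, ∫ r, G (x + (r - x i) • EuclideanSpace.single i (1 : ℝ))
        ∂(gaussianReal 0 1) ∂(Phi d)) ∧
      ∀ᵐ x ∂(Phi d), Integrable (fun r => G (x + (r - x i) • EuclideanSpace.single i (1 : ℝ)))
        (gaussianReal 0 1) := by
    intro G hG
    have hG' := (hp.integrable_comp hG.aestronglyMeasurable).2 hG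
    refine ⟨?_, hG'.prod_right_ae⟩
    conv_lhs => rw [← hp.map_eq]
    rw [integral_map hp.measurable.aemeasurable (by rw [hp.map_eq]; exact hG.aestronglyMeasurable)]
    exact integral_prod _ hG'
  -- After resampling, the inner variable is the i-th coordinate itself, so the one-dimensional
  -- identity applies on almost every line parallel to the i-th axis.
  rw [(key h1).1, (key h2).1]
  refine integral_congr_ae ?_
  filter_upwards [(key h0).2, (key h1).2, (key h2).2] with x k0 k1 k2
  have hc : ∀ r : ℝ, (x + (r - x i) • EuclideanSpace.single i (1 : ℝ)) i = r := by
    intro r; simp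
  simp only [hc] at k1 ⊢
  refine integral_mul_gaussianReal_eq (fun r => ?_) k0 k1 k2
  have h := hF (x + (r - x i) • EuclideanSpace.single i (1 : ℝ))
  rw [HasLineDerivAt] at h
  have h' : HasDerivAt (fun t => F (x + (r - x i) • EuclideanSpace.single i (1 : ℝ) +
      t • EuclideanSpace.single i (1 : ℝ)))
      (F' (x + (r - x i) • EuclideanSpace.single i (1 : ℝ))) (r - r) := by
    simpa using h
  have h4 := HasDerivAt.comp_sub_const r r h'
  refine h4.congr_of_eventuallyEq (Eventually.of_forall fun q => ?_)
  beta_reduce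
  rw [add_assoc, ← add_smul]
  congr 3
  ring

/-- A rotation of two independent standard normal vectors. -/
lemma measurePreserving_rotate {c s : ℝ} (h : c ^ 2 + s ^ 2 = 1) :
    MeasurePreserving (fun p : Vec d × Vec d => c • p.1 + s • p.2)
      ((Phi d).prod (Phi d)) (Phi d) := by
  have hm : Measurable (fun p : Vec d × Vec d => c • p.1 + s • p.2) := by fun_prop
  refine ⟨hm, ?_⟩
  have := Measure.isProbabilityMeasure_map (μ := (Phi d).prod (Phi d)) hm.aemeasurable
  refine Measure.ext_of_charFun ?_
  ext t
  rw [charFun_apply, integral_map hm.aemeasurable (by fun_prop)]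
  have h' : ∀ p : Vec d × Vec d,
      Complex.exp (⟪c • p.1 + s • p.2, t⟫ * Complex.I) =
      Complex.exp (⟪p.1, c • t⟫ * Complex.I) * Complex.exp (⟪p.2, s • t⟫ * Complex.I) := by
    intro p
    rw [← Complex.exp_add, ← add_mul, ← Complex.ofReal_add]
    congr 3
    simp [inner_add_left, inner_smul_left, inner_smul_right]
  simp_rw [h']
  rw [integral_prod_mul (fun x : Vec d => Complex.exp (⟪x, c • t⟫ * Complex.I))
      (fun x : Vec d => Complex.exp (⟪x, s • t⟫ * Complex.I)), ← charFun_apply, ← charFun_apply,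
    charFun_stdGaussian, charFun_stdGaussian, charFun_stdGaussian, ← Complex.exp_add]
  congr 1
  simp only [norm_smul, mul_pow, Complex.ofReal_mul, Real.norm_eq_abs]
  have e : ∀ r : ℝ, ((|r| : ℝ) : ℂ) ^ 2 = (r : ℂ) ^ 2 := fun r => by
    exact_mod_cast sq_abs r
  have h3 : (c : ℂ) ^ 2 + (s : ℂ) ^ 2 = 1 := by exact_mod_cast h
  rw [e, e]
  linear_combination (-(‖t‖ : ℂ) ^ 2 / 2) * h3

lemma integrable_norm_pow_stdGaussian (n : ℕ) : Integrable (fun z : Vec d => ‖z‖ ^ n) (Phi d) := by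
  have := (IsGaussian.memLp_id (Phi d) n (by simp)).integrable_norm_pow'
  simpa using this

lemma integral_norm_sq_stdGaussian : ∫ z, ‖z‖ ^ 2 ∂(Phi d) = d := by
  have hi : ∀ i : Fin d, Integrable (fun z : Vec d => z i * z i) (Phi d) := fun i => by
    refine (integrable_norm_pow_stdGaussian 2).mono' (by fun_prop) (ae_of_all _ fun z => ?_)
    rw [norm_mul, ← sq]
    gcongr
    exact PiLp.norm_apply_le z i
  have : ∀ i : Fin d, ∫ z : Vec d, z i * z i ∂(Phi d) = 1 := by
    intro i
    rw [integral_coord_mul_eq i (F := fun z => z i) (F' := fun _ => 1)]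
    · simp
    · intro x
      rw [HasLineDerivAt]
      simpa using (hasDerivAt_id (0 : ℝ)).const_add (x i)
    · refine (integrable_norm_pow_stdGaussian 1).mono' (by fun_prop) (ae_of_all _ fun z => ?_)
      simpa using PiLp.norm_apply_le z i
    · exact hi i
    · exact integrable_const _
  simp_rw [EuclideanSpace.real_norm_sq_eq, sq]
  rw [integral_finsetSum _ (fun i _ => hi i)]
  simp [this]

end ExchPair

/-! ### Gaussian averages of smooth functions: differentiation and Taylor expansion. -/

namespace ExchPair

open scoped ContDiff

variable {d : ℕ}

/-- The `i`-th standard basis vector. -/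
noncomputable abbrev stdVec (i : Fin d) : Vec d := EuclideanSpace.single i (1 : ℝ)

/-- The partial derivative in the direction of the `i`-th coordinate. -/
noncomputable def pderiv (i : Fin d) (h : Vec d → ℝ) (x : Vec d) : ℝ := fderiv ℝ h x (stdVec i)

/-- Smooth functions with compact support. -/
structure IsSmoothCompact (h : Vec d → ℝ) : Prop where
  contDiff : ContDiff ℝ ∞ h
  compact : HasCompactSupport h

namespace IsSmoothCompact

variable {h : Vec d → ℝ}

lemma partialDeriv (hh : IsSmoothCompact h) (i : Fin d) : IsSmoothCompact (pderiv i h) where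
  contDiff := (hh.contDiff.fderiv_right (m := ∞) (by simp)).clm_apply contDiff_const
  compact := hh.compact.fderiv_apply ℝ (stdVec i)

lemma continuous (hh : IsSmoothCompact h) : Continuous h := hh.contDiff.continuous

lemma exists_bound (hh : IsSmoothCompact h) : ∃ C, 0 ≤ C ∧ ∀ x, |h x| ≤ C := by
  obtain ⟨C, hC⟩ := hh.compact.exists_bound_of_continuous hh.continuous
  exact ⟨C, (norm_nonneg _).trans (hC 0), hC⟩

lemma hasDerivAt_comp (hh : IsSmoothCompact h) {U : ℝ → Vec d} {U' : Vec d} {r : ℝ}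
    (hU : HasDerivAt U U' r) :
    HasDerivAt (fun q => h (U q)) (∑ m, U' m * pderiv m h (U r)) r := by
  have h1 := ((hh.contDiff.differentiable (by simp)) (U r)).hasFDerivAt.comp_hasDerivAt r hU
  refine h1.congr_deriv ?_
  have h2 : U' = ∑ m, U' m • stdVec m := by
    ext j
    simp [Finset.sum_apply, Pi.single_apply]
  conv_lhs => rw [h2]
  simp [map_sum, pderiv]

lemma integrable_comp (hh : IsSmoothCompact h) {α : Type*} [MeasurableSpace α] {μ : Measure α}
    {p : α → ℝ} (hp : Integrable p μ) {U : α → Vec d} (hU : Measurable U) :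
    Integrable (fun a => p a * h (U a)) μ := by
  obtain ⟨C, -, hC⟩ := hh.exists_bound
  exact hp.mul_bdd (c := C) (hh.continuous.measurable.comp hU).aestronglyMeasurable
    (ae_of_all _ fun a => hC _)

lemma integrable_comp' (hh : IsSmoothCompact h) {α : Type*} [MeasurableSpace α] {μ : Measure α}
    [IsFiniteMeasure μ] {U : α → Vec d} (hU : Measurable U) :
    Integrable (fun a => h (U a)) μ := by
  simpa using hh.integrable_comp (integrable_const (μ := μ) (1 : ℝ)) hU

end IsSmoothCompact

/-- The average of `k` over the law of `c x + s Z` with `Z` standard normal. -/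
noncomputable def gaussAvg (c s : ℝ) (k : Vec d → ℝ) (x : Vec d) : ℝ :=
  ∫ z, k (c • x + s • z) ∂(Phi d)

lemma abs_gaussAvg_le {k : Vec d → ℝ} {C : ℝ} (hC : ∀ x, |k x| ≤ C) (c s : ℝ) (x : Vec d) :
    |gaussAvg c s k x| ≤ C := by
  have := norm_integral_le_of_norm_le_const (μ := Phi d) (f := fun z => k (c • x + s • z))
    (ae_of_all _ fun z => hC _)
  simpa [gaussAvg] using this

lemma IsSmoothCompact.continuous_gaussAvg {k : Vec d → ℝ} (hk : IsSmoothCompact k) (c s : ℝ) :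
    Continuous (gaussAvg c s k) := by
  obtain ⟨C, -, hC⟩ := hk.exists_bound
  have := hk.continuous
  exact continuous_of_dominated (fun x => by fun_prop) (fun x => ae_of_all _ fun z => hC _)
    (integrable_const C) (ae_of_all _ fun z => by fun_prop)

/-- Differentiation under the integral sign. Each derivative of the average moves onto k and costs
one factor c. -/
lemma IsSmoothCompact.hasDerivAt_gaussAvg_line {k : Vec d → ℝ} (hk : IsSmoothCompact k)
    (c s : ℝ) (x w : Vec d) (r : ℝ) :
    HasDerivAt (fun q : ℝ => gaussAvg c s k (x + q • w))
      (c * ∑ j, w j * gaussAvg c s (pderiv j k) (x + r • w)) r := by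
  choose C hC0 hC using fun j => (hk.partialDeriv j).exists_bound
  have hi : ∀ (j : Fin d) (q : ℝ),
      Integrable (fun z => pderiv j k (c • (x + q • w) + s • z)) (Phi d) :=
    fun j q => (hk.partialDeriv j).integrable_comp' (by fun_prop)
  have h := hasDerivAt_integral_of_dominated_loc_of_deriv_le (μ := Phi d) (x₀ := r)
    (s := Set.univ) (F := fun (q : ℝ) z => k (c • (x + q • w) + s • z))
    (F' := fun (q : ℝ) z => ∑ j, (c • w) j * pderiv j k (c • (x + q • w) + s • z))
    (bound := fun _ => ∑ j, |(c • w) j| * C j) univ_mem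
    (Eventually.of_forall fun q => by have := hk.continuous; fun_prop)
    (hk.integrable_comp' (by fun_prop))
    (integrable_finsetSum _ fun j _ => (hi j r).const_mul _).aestronglyMeasurable
    (ae_of_all _ fun z q _ => (Finset.abs_sum_le_sum_abs _ _).trans
      (Finset.sum_le_sum fun j _ => by
        rw [abs_mul]; exact mul_le_mul_of_nonneg_left (hC j _) (abs_nonneg _)))
    (integrable_const _)
    (ae_of_all _ fun z q _ => hk.hasDerivAt_comp (U' := c • w) (by
      have := ((((hasDerivAt_id q).smul_const w).const_add x).const_smul c).add_const (s • z)
      simpa using this))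
  refine h.2.congr_deriv ?_
  rw [integral_finsetSum _ fun j _ => (hi j r).const_mul _, Finset.mul_sum]
  refine Finset.sum_congr rfl fun j _ => ?_
  rw [integral_const_mul]
  simp [gaussAvg, mul_assoc]

/-- A first order Taylor expansion of a Gaussian average. -/
lemma IsSmoothCompact.abs_gaussAvg_taylor_le {k : Vec d → ℝ} (hk : IsSmoothCompact k)
    (c s : ℝ) {M : ℝ} (hM : ∀ j l x, |gaussAvg c s (pderiv l (pderiv j k)) x| ≤ M)
    (x w : Vec d) :
    |gaussAvg c s k (x + w) - gaussAvg c s k x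
      - c * ∑ j, w j * gaussAvg c s (pderiv j k) x|
      ≤ c ^ 2 * M * ∑ j, ∑ l, |w j * w l| := by
  set B := c ^ 2 * M * ∑ j, ∑ l, |w j * w l| with hB
  set g : ℝ → ℝ := fun q => gaussAvg c s k (x + q • w) with hg
  set g' : ℝ → ℝ := fun q => c * ∑ j, w j * gaussAvg c s (pderiv j k) (x + q • w)
    with hg'
  have hd : ∀ r, HasDerivAt g (g' r) r := fun r => hk.hasDerivAt_gaussAvg_line c s x w r
  have hd' : ∀ r, HasDerivAt g' (c * ∑ j, w j *
      (c * ∑ l, w l * gaussAvg c s (pderiv l (pderiv j k)) (x + r • w))) r := by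
    intro r
    refine HasDerivAt.const_mul c (HasDerivAt.fun_sum fun j _ => HasDerivAt.const_mul (w j) ?_)
    exact (hk.partialDeriv j).hasDerivAt_gaussAvg_line c s x w r
  have hb : ∀ r : ℝ, ‖c * ∑ j, w j *
      (c * ∑ l, w l * gaussAvg c s (pderiv l (pderiv j k)) (x + r • w))‖ ≤ B := by
    intro r
    have e : c * ∑ j, w j *
      (c * ∑ l, w l * gaussAvg c s (pderiv l (pderiv j k)) (x + r • w)) =
      c ^ 2 * ∑ j, ∑ l, (w j * w l) *
        gaussAvg c s (pderiv l (pderiv j k)) (x + r • w) := by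
      simp only [Finset.mul_sum]
      refine Finset.sum_congr rfl fun j _ => Finset.sum_congr rfl fun l _ => ?_
      ring
    rw [e, hB, Real.norm_eq_abs, abs_mul, abs_of_nonneg (sq_nonneg c), mul_assoc]
    refine mul_le_mul_of_nonneg_left ?_ (sq_nonneg c)
    rw [Finset.mul_sum]
    refine (Finset.abs_sum_le_sum_abs _ _).trans (Finset.sum_le_sum fun j _ => ?_)
    rw [Finset.mul_sum]
    refine (Finset.abs_sum_le_sum_abs _ _).trans (Finset.sum_le_sum fun l _ => ?_)
    rw [abs_mul, mul_comm]
    exact mul_le_mul_of_nonneg_right (hM j l _) (abs_nonneg _)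
  have hB0 : 0 ≤ B := (norm_nonneg _).trans (hb 0)
  -- The mean value inequality is used twice, for g' and then for g(q) - g'(0) q. This gives up the
  -- factor 1/2 of Taylor's formula, which only affects the constant.
  have h1 : ∀ r ∈ Set.Icc (0 : ℝ) 1, ‖g' r - g' 0‖ ≤ B := by
    intro r hr
    have := (convex_Icc (0 : ℝ) 1).norm_image_sub_le_of_norm_hasDerivWithin_le
      (fun q _ => (hd' q).hasDerivWithinAt) (fun q _ => hb q)
      (Set.left_mem_Icc.2 zero_le_one) hr
    refine this.trans ?_
    rw [sub_zero, Real.norm_eq_abs, abs_of_nonneg hr.1]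
    exact mul_le_of_le_one_right hB0 hr.2
  have h2 := (convex_Icc (0 : ℝ) 1).norm_image_sub_le_of_norm_hasDerivWithin_le
      (f := fun q => g q - g' 0 * q)
      (fun q _ => ((hd q).sub ((hasDerivAt_id q).const_mul (g' 0))).hasDerivWithinAt)
      (fun q hq => by simpa using h1 q hq)
      (Set.left_mem_Icc.2 zero_le_one) (Set.right_mem_Icc.2 zero_le_one)
  simp only [hg, hg', one_smul, zero_smul, add_zero, mul_one, mul_zero, sub_zero, norm_one,
    Real.norm_eq_abs] at h2
  convert h2 using 2
  ring

/-- Gaussian integration by parts for a test function with a polynomially growing weight. -/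
lemma IsSmoothCompact.integral_coord_mul_weight_eq {k : Vec d → ℝ} (hk : IsSmoothCompact k)
    (i : Fin d) (c s : ℝ) (x : Vec d) {p p' : Vec d → ℝ}
    (hp : ∀ z, HasLineDerivAt ℝ p (p' z) z (stdVec i)) (h0 : Integrable p (Phi d))
    (h1 : Integrable (fun z => z i * p z) (Phi d)) (h2 : Integrable p' (Phi d)) :
    ∫ z, z i * p z * k (c • x + s • z) ∂(Phi d) =
      ∫ z, p' z * k (c • x + s • z) ∂(Phi d)
        + s * ∫ z, p z * pderiv i k (c • x + s • z) ∂(Phi d) := by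
  have i0 := hk.integrable_comp h0 (U := fun z => c • x + s • z) (by fun_prop)
  have i1 := hk.integrable_comp h1 (U := fun z => c • x + s • z) (by fun_prop)
  have i2 := hk.integrable_comp h2 (U := fun z => c • x + s • z) (by fun_prop)
  have i3 := (hk.partialDeriv i).integrable_comp h0 (U := fun z => c • x + s • z) (by fun_prop)
  rw [← integral_const_mul, ← integral_add i2 (i3.const_mul s)]
  simp_rw [mul_assoc] at i1 ⊢
  refine integral_coord_mul_eq i (fun z => ?_) i0 i1 (i2.add (i3.const_mul s))
  have e1 := hp z
  rw [HasLineDerivAt] at e1 ⊢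
  have e2 : HasDerivAt (fun t : ℝ => k (c • x + s • (z + t • stdVec i)))
      (s * pderiv i k (c • x + s • z)) 0 := by
    have := hk.hasDerivAt_comp (U := fun t : ℝ => c • x + s • (z + t • stdVec i))
      (U' := s • stdVec i) (r := 0) (by
        have := (((hasDerivAt_id (0 : ℝ)).smul_const (stdVec i)).const_add z).const_smul s
        simpa using this.const_add (c • x))
    simpa [Pi.single_apply] using this
  refine (e1.mul e2).congr_deriv ?_
  simp
  ring

lemma abs_coord_le_norm (z : Vec d) (i : Fin d) : |z i| ≤ ‖z‖ := PiLp.norm_apply_le z i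

lemma integrable_coord (i : Fin d) : Integrable (fun z : Vec d => z i) (Phi d) :=
  (integrable_norm_pow_stdGaussian 1).mono' (by fun_prop) (ae_of_all _ fun z => by
    simpa using abs_coord_le_norm z i)

lemma abs_coord_mul_le (z : Vec d) (i j : Fin d) : |z i * z j| ≤ ‖z‖ ^ 2 := by
  rw [abs_mul, sq]
  gcongr <;> exact abs_coord_le_norm z _

lemma abs_coord_mul_mul_le (z : Vec d) (i j l : Fin d) : |z i * (z j * z l)| ≤ ‖z‖ ^ 3 := by
  rw [abs_mul, pow_succ']
  gcongr
  · exact abs_coord_le_norm z _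
  · exact abs_coord_mul_le z _ _

lemma integrable_coord_mul (i j : Fin d) : Integrable (fun z : Vec d => z i * z j) (Phi d) :=
  (integrable_norm_pow_stdGaussian 2).mono' (by fun_prop)
    (ae_of_all _ fun z => abs_coord_mul_le z i j)

lemma integrable_coord_mul_mul (i j l : Fin d) :
    Integrable (fun z : Vec d => z i * (z j * z l)) (Phi d) :=
  (integrable_norm_pow_stdGaussian 3).mono' (by fun_prop)
    (ae_of_all _ fun z => abs_coord_mul_mul_le z i j l)

lemma hasLineDerivAt_coord (i j : Fin d) (z : Vec d) :
    HasLineDerivAt ℝ (fun z : Vec d => z j) (stdVec i j) z (stdVec i) := by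
  rw [HasLineDerivAt]
  have := ((hasDerivAt_id (0 : ℝ)).mul_const (stdVec i j)).const_add (z j)
  simpa using this

lemma hasLineDerivAt_coord_mul (i j l : Fin d) (z : Vec d) :
    HasLineDerivAt ℝ (fun z : Vec d => z j * z l) (stdVec i j * z l + z j * stdVec i l) z
      (stdVec i) := by
  have h1 := hasLineDerivAt_coord i j z
  have h2 := hasLineDerivAt_coord i l z
  rw [HasLineDerivAt] at *
  have h3 := h1.fun_mul h2
  simp only [zero_smul, add_zero] at h3
  exact h3

lemma abs_stdVec_le (i j : Fin d) : |stdVec i j| ≤ 1 := by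
  simp only [PiLp.single_apply]
  split_ifs <;> simp

/-! ### Derivative bounds that depend on the test function only through its sup norm. -/

section Bounds

variable {k : Vec d → ℝ} {c s : ℝ}

lemma abs_integral_weight_le {p q : Vec d → ℝ} (hk1 : ∀ x, |k x| ≤ 1) (hq : Integrable q (Phi d))
    (hpq : ∀ z, |p z| ≤ q z) (x : Vec d) :
    |∫ z, p z * k (c • x + s • z) ∂(Phi d)| ≤ ∫ z, q z ∂(Phi d) := by
  refine norm_integral_le_of_norm_le (f := fun z => p z * k (c • x + s • z)) hq (ae_of_all _ fun z => ?_)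
  rw [norm_mul]
  exact (mul_le_of_le_one_right (norm_nonneg _) (hk1 _)).trans (hpq z)

variable (d) in
/-- A bound for the absolute moments of the standard normal distribution up to order three. -/
noncomputable def momentBound : ℝ := ∫ z : Vec d, (1 + ‖z‖) ^ 3 ∂(Phi d)

lemma integrable_one_add_norm_pow : Integrable (fun z : Vec d => (1 + ‖z‖) ^ 3) (Phi d) := by
  have h : (fun z : Vec d => (1 + ‖z‖) ^ 3) =
      fun z => 1 + 3 * ‖z‖ ^ 1 + 3 * ‖z‖ ^ 2 + ‖z‖ ^ 3 := by ext z; ring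
  rw [h]
  exact (((integrable_const _).add ((integrable_norm_pow_stdGaussian 1).const_mul _)).add
    ((integrable_norm_pow_stdGaussian 2).const_mul _)).add (integrable_norm_pow_stdGaussian 3)

lemma abs_integral_weight_le_momentBound {p : Vec d → ℝ} (hk1 : ∀ x, |k x| ≤ 1)
    (hp : ∀ z, |p z| ≤ (1 + ‖z‖) ^ 3) (x : Vec d) :
    |∫ z, p z * k (c • x + s • z) ∂(Phi d)| ≤ momentBound d :=
  abs_integral_weight_le hk1 integrable_one_add_norm_pow hp x

lemma one_le_momentBound : 1 ≤ momentBound d := by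
  have := integral_mono (μ := Phi d) (integrable_const (1 : ℝ)) integrable_one_add_norm_pow
    (fun z => one_le_pow₀ (by linarith [norm_nonneg z]))
  simpa [momentBound] using this

/-- Integration by parts replaces s ∂_i k by the weight z_i on k itself, so no derivative of k is
left. The two lemmas that follow treat weighted integrals in the same way, as input for the
derivatives of order two and three. -/
lemma IsSmoothCompact.mul_abs_integral_pderiv_le (hk : IsSmoothCompact k) (hk1 : ∀ x, |k x| ≤ 1)
    (hs : 0 < s) (i : Fin d) (x : Vec d) :
    s * |∫ z, pderiv i k (c • x + s • z) ∂(Phi d)| ≤ momentBound d := by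
  have h := hk.integral_coord_mul_weight_eq i c s x (p := fun _ => 1) (p' := fun _ => 0)
    (fun z => by rw [HasLineDerivAt]; exact hasDerivAt_const _ _) (integrable_const _)
    (by simpa using integrable_coord i) (integrable_const _)
  simp only [mul_one, zero_mul, integral_zero, zero_add, one_mul] at h
  rw [← abs_of_pos hs, ← abs_mul, abs_of_pos hs, ← h]
  refine abs_integral_weight_le_momentBound hk1 (fun z => (abs_coord_le_norm z i).trans ?_) x
  -- All polynomial weights that occur are dominated by (1 + |z|)³, so a single moment serves as the
  -- constant throughout.
  nlinarith [norm_nonneg z, sq_nonneg ‖z‖, pow_nonneg (norm_nonneg z) 3]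

lemma IsSmoothCompact.mul_abs_integral_coord_mul_pderiv_le (hk : IsSmoothCompact k)
    (hk1 : ∀ x, |k x| ≤ 1) (hs : 0 < s) (i j : Fin d) (x : Vec d) :
    s * |∫ z, z j * pderiv i k (c • x + s • z) ∂(Phi d)| ≤ 2 * momentBound d := by
  have h := hk.integral_coord_mul_weight_eq i c s x (p := fun z => z j)
    (p' := fun _ => stdVec i j) (hasLineDerivAt_coord i j) (integrable_coord j)
    (integrable_coord_mul i j) (integrable_const _)
  rw [← abs_of_pos hs, ← abs_mul, abs_of_pos hs]
  rw [← sub_eq_iff_eq_add'] at h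
  rw [← h]
  refine (abs_sub _ _).trans ?_
  have h1 : |∫ z, z i * z j * k (c • x + s • z) ∂(Phi d)| ≤ momentBound d := by
    refine abs_integral_weight_le_momentBound hk1 (fun z => (abs_coord_mul_le z i j).trans ?_) x
    nlinarith [norm_nonneg z, sq_nonneg ‖z‖, pow_nonneg (norm_nonneg z) 3]
  have h2 : |∫ z, stdVec i j * k (c • x + s • z) ∂(Phi d)| ≤ momentBound d := by
    refine abs_integral_weight_le_momentBound hk1 (fun z => (abs_stdVec_le i j).trans ?_) x
    exact one_le_pow₀ (by linarith [norm_nonneg z])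
  linarith

lemma IsSmoothCompact.mul_abs_integral_coord_mul_mul_pderiv_le (hk : IsSmoothCompact k)
    (hk1 : ∀ x, |k x| ≤ 1) (hs : 0 < s) (i j l : Fin d) (x : Vec d) :
    s * |∫ z, z j * z l * pderiv i k (c • x + s • z) ∂(Phi d)| ≤ 2 * momentBound d := by
  have h := hk.integral_coord_mul_weight_eq i c s x (p := fun z => z j * z l)
    (p' := fun z => stdVec i j * z l + z j * stdVec i l) (hasLineDerivAt_coord_mul i j l)
    (integrable_coord_mul j l) (integrable_coord_mul_mul i j l)
    (((integrable_coord l).const_mul _).add ((integrable_coord j).mul_const _))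
  rw [← abs_of_pos hs, ← abs_mul, abs_of_pos hs]
  rw [← sub_eq_iff_eq_add'] at h
  rw [← h]
  refine (abs_sub _ _).trans ?_
  have h1 : |∫ z, z i * (z j * z l) * k (c • x + s • z) ∂(Phi d)| ≤ momentBound d := by
    refine abs_integral_weight_le_momentBound hk1
      (fun z => (abs_coord_mul_mul_le z i j l).trans ?_) x
    gcongr
    linarith
  have h2 : |∫ z, (stdVec i j * z l + z j * stdVec i l) * k (c • x + s • z) ∂(Phi d)|
      ≤ momentBound d := by
    refine abs_integral_weight_le_momentBound hk1 (fun z => (abs_add_le _ _).trans ?_) x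
    rw [abs_mul, abs_mul]
    have e1 := mul_le_mul (abs_stdVec_le i j) (abs_coord_le_norm z l) (abs_nonneg _) zero_le_one
    have e2 := mul_le_mul (abs_coord_le_norm z j) (abs_stdVec_le i l) (abs_nonneg _)
      (norm_nonneg z)
    nlinarith [norm_nonneg z, sq_nonneg ‖z‖, pow_nonneg (norm_nonneg z) 3]
  linarith

lemma IsSmoothCompact.abs_gaussAvg_pderiv_le (hk : IsSmoothCompact k) (hk1 : ∀ x, |k x| ≤ 1)
    (hs : 0 < s) (i : Fin d) (x : Vec d) :
    |gaussAvg c s (pderiv i k) x| ≤ momentBound d / s := by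
  rw [le_div_iff₀' hs]
  exact hk.mul_abs_integral_pderiv_le hk1 hs i x

lemma IsSmoothCompact.abs_gaussAvg_pderiv_pderiv_le (hk : IsSmoothCompact k)
    (hk1 : ∀ x, |k x| ≤ 1) (hs : 0 < s) (i j : Fin d) (x : Vec d) :
    |gaussAvg c s (pderiv j (pderiv i k)) x| ≤ 2 * momentBound d / s ^ 2 := by
  rw [le_div_iff₀' (by positivity)]
  have h := (hk.partialDeriv i).integral_coord_mul_weight_eq j c s x (p := fun _ => 1) (p' := fun _ => 0)
    (fun z => by rw [HasLineDerivAt]; exact hasDerivAt_const _ _) (integrable_const _)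
    (by simpa using integrable_coord j) (integrable_const _)
  simp only [mul_one, zero_mul, integral_zero, zero_add, one_mul] at h
  have := hk.mul_abs_integral_coord_mul_pderiv_le (c := c) hk1 hs i j x
  rw [h, abs_mul, abs_of_pos hs] at this
  rw [gaussAvg, sq, mul_assoc]
  exact this

/-- Two integrations by parts, in the directions l and j, trade two derivatives for the weight z_j
z_l minus the constant δ_{jl}. The remaining derivative ∂_i is removed by the weighted bounds, which
contribute 2 + 1 = 3 moments. -/
lemma IsSmoothCompact.abs_gaussAvg_pderiv_pderiv_pderiv_le (hk : IsSmoothCompact k)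
    (hk1 : ∀ x, |k x| ≤ 1) (hs : 0 < s) (i j l : Fin d) (x : Vec d) :
    |gaussAvg c s (pderiv l (pderiv j (pderiv i k))) x|
      ≤ 3 * momentBound d / s ^ 3 := by
  rw [le_div_iff₀' (by positivity)]
  have h := (hk.partialDeriv i).integral_coord_mul_weight_eq j c s x (p := fun z => z l)
    (p' := fun _ => stdVec j l) (hasLineDerivAt_coord j l) (integrable_coord l)
    (integrable_coord_mul j l) (integrable_const _)
  have h' := ((hk.partialDeriv i).partialDeriv j).integral_coord_mul_weight_eq l c s x (p := fun _ => 1)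
    (p' := fun _ => 0)
    (fun z => by rw [HasLineDerivAt]; exact hasDerivAt_const _ _) (integrable_const _)
    (by simpa using integrable_coord l) (integrable_const _)
  simp only [mul_one, zero_mul, integral_zero, zero_add, one_mul] at h'
  have b1 := hk.mul_abs_integral_coord_mul_mul_pderiv_le (c := c) hk1 hs i j l x
  have b2 := hk.mul_abs_integral_pderiv_le (c := c) hk1 hs i x
  rw [integral_const_mul, h'] at h
  set A := ∫ z, z j * z l * pderiv i k (c • x + s • z) ∂(Phi d)
  set B := ∫ z, pderiv i k (c • x + s • z) ∂(Phi d)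
  rw [gaussAvg]
  set G := ∫ z, pderiv l (pderiv j (pderiv i k)) (c • x + s • z) ∂(Phi d)
  have e : s ^ 3 * |G| = s * |s * (s * G)| := by
    rw [abs_mul, abs_mul, abs_of_pos hs]; ring
  have e' : s * (s * G) = A - stdVec j l * B := by linarith
  rw [e, e']
  have b3 : |A - stdVec j l * B| ≤ |A| + |B| := by
    refine (abs_sub _ _).trans ?_
    rw [abs_mul]
    have := mul_le_of_le_one_left (abs_nonneg B) (abs_stdVec_le j l)
    linarith
  calc s * |A - stdVec j l * B| ≤ s * (|A| + |B|) := by gcongr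
    _ ≤ 3 * momentBound d := by linarith

end Bounds

end ExchPair

/-! ### Interpolation by rotation. -/

namespace ExchPair

variable {d : ℕ}

/-- Gaussian integration by parts for a test function. -/
lemma IsSmoothCompact.integral_coord_mul_gaussAvg {k : Vec d → ℝ} (hk : IsSmoothCompact k)
    (i : Fin d) (c s : ℝ) (x : Vec d) :
    ∫ z, z i * k (c • x + s • z) ∂(Phi d) = s * gaussAvg c s (pderiv i k) x := by
  have h := hk.integral_coord_mul_weight_eq i c s x (p := fun _ => 1) (p' := fun _ => 0)
    (fun z => by rw [HasLineDerivAt]; exact hasDerivAt_const _ _) (integrable_const _)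
    (by simpa using integrable_coord i) (integrable_const _)
  simpa [gaussAvg] using h

/-- Interpolation along a rotation between the law `ν` and the standard normal distribution. -/
lemma IsSmoothCompact.hasDerivAt_integral_gaussAvg {h : Vec d → ℝ} (hh : IsSmoothCompact h)
    {ν : Measure (Vec d)} [IsProbabilityMeasure ν] (hν : Integrable (fun y => ‖y‖) ν) (θ : ℝ) :
    HasDerivAt (fun θ => ∫ y, gaussAvg (Real.cos θ) (Real.sin θ) h y ∂ν)
      (Real.sin θ * ∫ y, ∑ m, (Real.cos θ *
        gaussAvg (Real.cos θ) (Real.sin θ) (pderiv m (pderiv m h)) y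
          - y m * gaussAvg (Real.cos θ) (Real.sin θ) (pderiv m h) y) ∂ν) θ := by
  choose C hC0 hC using fun j => (hh.partialDeriv j).exists_bound
  have hy : ∀ m : Fin d, Integrable (fun y : Vec d => y m) ν := fun m =>
    hν.mono' (by fun_prop) (ae_of_all _ fun y => abs_coord_le_norm y m)
  have hpy : ∀ m : Fin d, Integrable (fun p : Vec d × Vec d => p.1 m) (ν.prod (Phi d)) :=
    fun m => (hy m).comp_fst (Phi d)
  have hpz : ∀ m : Fin d, Integrable (fun p : Vec d × Vec d => p.2 m) (ν.prod (Phi d)) :=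
    fun m => (integrable_coord m).comp_snd ν
  have hiy : ∀ m : Fin d, Integrable (fun p : Vec d × Vec d =>
      p.1 m * pderiv m h (Real.cos θ • p.1 + Real.sin θ • p.2)) (ν.prod (Phi d)) :=
    fun m => (hh.partialDeriv m).integrable_comp (hpy m) (by fun_prop)
  have hiz : ∀ m : Fin d, Integrable (fun p : Vec d × Vec d =>
      p.2 m * pderiv m h (Real.cos θ • p.1 + Real.sin θ • p.2)) (ν.prod (Phi d)) :=
    fun m => (hh.partialDeriv m).integrable_comp (hpz m) (by fun_prop)
  have hF : (fun θ => ∫ y, gaussAvg (Real.cos θ) (Real.sin θ) h y ∂ν) =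
      fun θ => ∫ p, h (Real.cos θ • p.1 + Real.sin θ • p.2) ∂(ν.prod (Phi d)) := by
    ext θ
    rw [integral_prod _ (hh.integrable_comp' (by fun_prop))]
    rfl
  have e : ∀ (q : ℝ) (p : Vec d × Vec d) (m : Fin d),
      (-Real.sin q • p.1 + Real.cos q • p.2) m = -Real.sin q * p.1 m + Real.cos q * p.2 m := by
    intro q p m; simp
  -- As |sin| and |cos| are at most 1, the derivative is dominated by a multiple of |y_m| + |z_m|
  -- uniformly in the angle. This is where the first moment of ν is needed.
  have key := hasDerivAt_integral_of_dominated_loc_of_deriv_le (μ := ν.prod (Phi d)) (x₀ := θ)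
    (s := Set.univ) (F := fun (q : ℝ) p => h (Real.cos q • p.1 + Real.sin q • p.2))
    (F' := fun (q : ℝ) p => ∑ m, (-Real.sin q • p.1 + Real.cos q • p.2) m *
      pderiv m h (Real.cos q • p.1 + Real.sin q • p.2))
    (bound := fun p => ∑ m, (|p.1 m| + |p.2 m|) * C m) univ_mem
    (Eventually.of_forall fun q => by have := hh.continuous; fun_prop)
    (hh.integrable_comp' (by fun_prop))
    (by
      refine (integrable_finsetSum _ fun m _ => ?_).aestronglyMeasurable
      refine (((hiy m).const_mul (-Real.sin θ)).add ((hiz m).const_mul (Real.cos θ))).congr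
        (ae_of_all _ fun p => ?_)
      simp only [Pi.add_apply, e]
      ring)
    (ae_of_all _ fun p q _ => (Finset.abs_sum_le_sum_abs _ _).trans
      (Finset.sum_le_sum fun m _ => by
        rw [abs_mul, e]
        refine mul_le_mul ((abs_add_le _ _).trans ?_) (hC m _) (abs_nonneg _) (by positivity)
        rw [abs_mul, abs_mul, abs_neg]
        exact add_le_add (mul_le_of_le_one_left (abs_nonneg _) (Real.abs_sin_le_one q))
          (mul_le_of_le_one_left (abs_nonneg _) (Real.abs_cos_le_one q))))
    (integrable_finsetSum _ fun m _ => ((hpy m).abs.add (hpz m).abs).mul_const _)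
    (ae_of_all _ fun p q _ => hh.hasDerivAt_comp
      (((Real.hasDerivAt_cos q).smul_const p.1).add ((Real.hasDerivAt_sin q).smul_const p.2)))
  rw [hF]
  refine key.2.congr_deriv ?_
  have hTm : ∀ m : Fin d, Integrable (fun y : Vec d =>
      gaussAvg (Real.cos θ) (Real.sin θ) (pderiv m (pderiv m h)) y) ν := fun m => by
    obtain ⟨B, -, hB⟩ := ((hh.partialDeriv m).partialDeriv m).exists_bound
    exact Integrable.of_bound (((hh.partialDeriv m).partialDeriv m).continuous_gaussAvg _ _
      |>.aestronglyMeasurable) B (ae_of_all _ fun y => abs_gaussAvg_le hB _ _ y)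
  have hTy : ∀ m : Fin d, Integrable (fun y : Vec d =>
      y m * gaussAvg (Real.cos θ) (Real.sin θ) (pderiv m h) y) ν := fun m =>
    (hy m).mul_bdd (c := C m) ((hh.partialDeriv m).continuous_gaussAvg _ _).aestronglyMeasurable
      (ae_of_all _ fun y => abs_gaussAvg_le (hC m) _ _ y)
  have hTd : ∀ m : Fin d, Integrable (fun y : Vec d => Real.cos θ *
      gaussAvg (Real.cos θ) (Real.sin θ) (pderiv m (pderiv m h)) y
        - y m * gaussAvg (Real.cos θ) (Real.sin θ) (pderiv m h) y) ν :=
    fun m => ((hTm m).const_mul _).sub (hTy m)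
  rw [integral_finsetSum _ fun m _ => hTd m, Finset.mul_sum,
    integral_finsetSum]
  · refine Finset.sum_congr rfl fun m _ => ?_
    rw [integral_sub ((hTm m).const_mul _) (hTy m), integral_const_mul]
    have e2 : ∀ p : Vec d × Vec d, (-Real.sin θ • p.1 + Real.cos θ • p.2) m *
        pderiv m h (Real.cos θ • p.1 + Real.sin θ • p.2) =
        -Real.sin θ * (p.1 m * pderiv m h (Real.cos θ • p.1 + Real.sin θ • p.2)) +
        Real.cos θ * (p.2 m * pderiv m h (Real.cos θ • p.1 + Real.sin θ • p.2)) := by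
      intro p; rw [e]; ring
    simp_rw [e2]
    rw [integral_add ((hiy m).const_mul _) ((hiz m).const_mul _), integral_const_mul,
      integral_const_mul, integral_prod _ (hiy m), integral_prod _ (hiz m)]
    -- Integrating the z-part by parts produces sin θ times a second derivative, so sin θ becomes a
    -- common factor and the Stein expression is left.
    simp only [integral_const_mul, (hh.partialDeriv m).integral_coord_mul_gaussAvg]
    have e3 : ∀ y : Vec d, ∫ z, pderiv m h (Real.cos θ • y + Real.sin θ • z) ∂(Phi d) =
      gaussAvg (Real.cos θ) (Real.sin θ) (pderiv m h) y := fun y => rfl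
    simp only [e3]
    ring
  · intro m _
    refine (((hiy m).const_mul (-Real.sin θ)).add ((hiz m).const_mul (Real.cos θ))).congr
      (ae_of_all _ fun p => ?_)
    simp only [Pi.add_apply, e]
    ring

end ExchPair

/-! ### The Stein identity for a normalized exchangeable pair. -/

namespace ExchPair

variable {d : ℕ} {Ω : Type*} [MeasurableSpace Ω] {μ : Measure Ω}

lemma abs_integral_mul_le_sqrt_mul_sqrt {f g : Ω → ℝ} (hf : MemLp f 2 μ) (hg : MemLp g 2 μ) :
    |∫ ω, f ω * g ω ∂μ| ≤ √(∫ ω, f ω ^ 2 ∂μ) * √(∫ ω, g ω ^ 2 ∂μ) := by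
  have h := integral_mul_norm_le_Lp_mul_Lq (μ := μ) (p := 2) (q := 2) Real.HolderConjugate.two_two
    (f := f) (g := g) (by simpa using hf) (by simpa using hg)
  simp only [Real.norm_eq_abs, Real.rpow_ofNat, sq_abs, ← Real.sqrt_eq_rpow] at h
  refine le_trans ?_ h
  refine abs_integral_le_integral_abs.trans_eq ?_
  simp_rw [abs_mul]

lemma abs_integral_mul_le_mul_sqrt [IsProbabilityMeasure μ] {f g : Ω → ℝ} {M : ℝ}
    (hM : 0 ≤ M) (hf : MemLp f 2 μ) (hg : AEStronglyMeasurable g μ) (hgM : ∀ ω, |g ω| ≤ M) :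
    |∫ ω, f ω * g ω ∂μ| ≤ M * √(∫ ω, f ω ^ 2 ∂μ) := by
  have hg2 : MemLp g 2 μ := MemLp.of_bound hg M (ae_of_all _ hgM)
  refine (abs_integral_mul_le_sqrt_mul_sqrt hf hg2).trans ?_
  rw [mul_comm]
  refine mul_le_mul_of_nonneg_right ?_ (Real.sqrt_nonneg _)
  rw [Real.sqrt_le_left hM]
  have := integral_mono hg2.integrable_sq (integrable_const (M ^ 2))
    (fun ω => sq_le_sq' (abs_le.1 (hgM ω)).1 (abs_le.1 (hgM ω)).2)
  simpa using this

/-- An exchangeable pair with identity covariance; `P` is the inverse of the regression matrix and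
`ρ` the remainder. -/
structure IsNormalizedPair (μ : Measure Ω) (Y Y' ρ : Ω → Vec d) (P : Mat d) : Prop where
  measurable_left : Measurable Y
  measurable_right : Measurable Y'
  exchangeable : μ.map (fun ω => (Y ω, Y' ω)) = μ.map (fun ω => (Y' ω, Y ω))
  memLp_left : ∀ i, MemLp (fun ω => Y ω i) 2 μ
  memLp_remainder : ∀ i, MemLp (fun ω => ρ ω i) 2 μ
  cov : ∀ i j, ∫ ω, Y ω i * Y ω j ∂μ = if i = j then 1 else 0
  regression : ∀ (m : Fin d) (G : Vec d → ℝ), Measurable G → MemLp (fun ω => G (Y ω)) 2 μ →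
    ∑ i, P m i * ∫ ω, (Y' ω i - Y ω i) * G (Y ω) ∂μ =
      -(∫ ω, Y ω m * G (Y ω) ∂μ) + ∑ i, P m i * ∫ ω, ρ ω i * G (Y ω) ∂μ

namespace IsNormalizedPair

variable {Y Y' ρ : Ω → Vec d} {P : Mat d}

lemma integral_swap (hY : IsNormalizedPair μ Y Y' ρ P) {f : Vec d × Vec d → ℝ}
    (hf : Measurable f) : ∫ ω, f (Y ω, Y' ω) ∂μ = ∫ ω, f (Y' ω, Y ω) ∂μ := by
  have h1 := hY.measurable_left
  have h2 := hY.measurable_right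
  rw [← integral_map (f := f) (φ := fun ω => (Y ω, Y' ω)) (by fun_prop)
    hf.aestronglyMeasurable, hY.exchangeable, integral_map (by fun_prop) hf.aestronglyMeasurable]

lemma map_eq (hY : IsNormalizedPair μ Y Y' ρ P) : μ.map Y' = μ.map Y := by
  have h1 := hY.measurable_left
  have h2 := hY.measurable_right
  have := congrArg (Measure.map Prod.snd) hY.exchangeable
  rw [Measure.map_map (by fun_prop) (by fun_prop), Measure.map_map (by fun_prop) (by fun_prop)]
    at this
  exact this

lemma memLp_right (hY : IsNormalizedPair μ Y Y' ρ P) (i : Fin d) :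
    MemLp (fun ω => Y' ω i) 2 μ := by
  have h1 := hY.measurable_left
  have h2 := hY.measurable_right
  have hm : Measurable fun x : Vec d => x i := by fun_prop
  have := hY.memLp_left i
  rw [show (fun ω => Y ω i) = (fun x : Vec d => x i) ∘ Y from rfl,
    ← memLp_map_measure_iff hm.aestronglyMeasurable h1.aemeasurable, ← hY.map_eq,
    memLp_map_measure_iff hm.aestronglyMeasurable h2.aemeasurable] at this
  exact this

lemma memLp_incr (hY : IsNormalizedPair μ Y Y' ρ P) (i : Fin d) :
    MemLp (fun ω => Y' ω i - Y ω i) 2 μ := (hY.memLp_right i).sub (hY.memLp_left i)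

/-- The integrand is antisymmetric in the pair. This is how exchangeability enters the Stein
argument: it turns E Δ_i g(Y) into -½ E Δ_i (g(Y') - g(Y)). -/
lemma integral_incr_mul_add (hY : IsNormalizedPair μ Y Y' ρ P) (i : Fin d) {g : Vec d → ℝ}
    (hg : Measurable g) : ∫ ω, (Y' ω i - Y ω i) * (g (Y' ω) + g (Y ω)) ∂μ = 0 := by
  have h := hY.integral_swap (f := fun p => (p.2 i - p.1 i) * (g p.2 + g p.1)) (by fun_prop)
  have h2 : ∫ ω, (Y ω i - Y' ω i) * (g (Y ω) + g (Y' ω)) ∂μ =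
      -∫ ω, (Y' ω i - Y ω i) * (g (Y' ω) + g (Y ω)) ∂μ := by
    rw [← integral_neg]
    congr 1
    ext ω
    ring
  simp only at h
  linarith

/-- The covariance identity implied by exchangeability and the regression property. -/
lemma sum_mul_cov_incr (hY : IsNormalizedPair μ Y Y' ρ P) (m j : Fin d) :
    ∑ i, P m i * (1 / 2 * ∫ ω, (Y' ω i - Y ω i) * (Y' ω j - Y ω j) ∂μ
      + ∫ ω, ρ ω i * Y ω j ∂μ) = if m = j then 1 else 0 := by
  -- The regression property is tested with a linear function; antisymmetry then rewrites E Δ_i Y_j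
  -- as -½ E Δ_i Δ_j.
  have h1 := hY.regression m (fun x => x j) (by fun_prop) (hY.memLp_left j)
  have h2 : ∀ i, ∫ ω, (Y' ω i - Y ω i) * Y ω j ∂μ =
      -(1 / 2 * ∫ ω, (Y' ω i - Y ω i) * (Y' ω j - Y ω j) ∂μ) := by
    intro i
    have h3 := hY.integral_incr_mul_add i (g := fun x => x j) (by fun_prop)
    have i1 : Integrable (fun ω => (Y' ω i - Y ω i) * Y' ω j) μ :=
      (hY.memLp_incr i).integrable_mul (hY.memLp_right j)
    have i2 : Integrable (fun ω => (Y' ω i - Y ω i) * Y ω j) μ :=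
      (hY.memLp_incr i).integrable_mul (hY.memLp_left j)
    have e1 : ∫ ω, (Y' ω i - Y ω i) * (Y' ω j + Y ω j) ∂μ =
        ∫ ω, (Y' ω i - Y ω i) * Y' ω j ∂μ + ∫ ω, (Y' ω i - Y ω i) * Y ω j ∂μ := by
      rw [← integral_add i1 i2]
      simp [mul_add]
    have e2 : ∫ ω, (Y' ω i - Y ω i) * (Y' ω j - Y ω j) ∂μ =
        ∫ ω, (Y' ω i - Y ω i) * Y' ω j ∂μ - ∫ ω, (Y' ω i - Y ω i) * Y ω j ∂μ := by
      rw [← integral_sub i1 i2]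
      simp [mul_sub]
    linarith
  simp_rw [h2, hY.cov] at h1
  simp_rw [mul_add, Finset.sum_add_distrib]
  simp_rw [mul_neg, Finset.sum_neg_distrib] at h1
  linarith

/-- Cauchy-Schwarz with E Y_j² = 1. The bound does not depend on j, so summing it over j produces
the term C' d in D'. -/
lemma abs_integral_remainder_mul_coord_le (hY : IsNormalizedPair μ Y Y' ρ P) (i j : Fin d) :
    |∫ ω, ρ ω i * Y ω j ∂μ| ≤ √(∫ ω, ρ ω i ^ 2 ∂μ) := by
  have h := abs_integral_mul_le_sqrt_mul_sqrt (hY.memLp_remainder i) (hY.memLp_left j)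
  have h2 : ∫ ω, Y ω j ^ 2 ∂μ = 1 := by
    simp_rw [sq]; rw [hY.cov]; simp
  simpa [h2] using h

variable [IsProbabilityMeasure μ]

/-- Conditioning on Y replaces Δ_i Δ_j by V, so the difference is minus the covariance of V and
g(Y), and Cauchy-Schwarz applies. This is the source of A'. -/
lemma abs_cov_sub_le (hY : IsNormalizedPair μ Y Y' ρ P) (i j : Fin d)
    {V : Ω → ℝ} (hVdef : V = μ[fun ω => (Y' ω i - Y ω i) * (Y' ω j - Y ω j) | sig Y])
    (hV : MemLp V 2 μ) {g : Vec d → ℝ} (hg : Measurable g) {M : ℝ} (hM : 0 ≤ M)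
    (hgM : ∀ x, |g x| ≤ M) :
    |(∫ ω, (Y' ω i - Y ω i) * (Y' ω j - Y ω j) ∂μ) * (∫ ω, g (Y ω) ∂μ) -
      ∫ ω, (Y' ω i - Y ω i) * (Y' ω j - Y ω j) * g (Y ω) ∂μ| ≤ M * √(variance V μ) := by
  have hle : sig Y ≤ ‹MeasurableSpace Ω› := hY.measurable_left.comap_le
  have hgY : StronglyMeasurable[sig Y] (fun ω => g (Y ω)) :=
    (hg.comp (comap_measurable Y)).stronglyMeasurable
  have hgYm : AEStronglyMeasurable (fun ω => g (Y ω)) μ :=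
    (hg.comp hY.measurable_left).aestronglyMeasurable
  have hD : Integrable (fun ω => (Y' ω i - Y ω i) * (Y' ω j - Y ω j)) μ :=
    (hY.memLp_incr i).integrable_mul (hY.memLp_incr j)
  have hDg : Integrable (fun ω => (Y' ω i - Y ω i) * (Y' ω j - Y ω j) * g (Y ω)) μ :=
    hD.mul_bdd (c := M) hgYm (ae_of_all _ fun ω => hgM _)
  have e1 : ∫ ω, (Y' ω i - Y ω i) * (Y' ω j - Y ω j) ∂μ = ∫ ω, V ω ∂μ := by
    rw [hVdef, integral_condExp hle]
  have e2 : ∫ ω, (Y' ω i - Y ω i) * (Y' ω j - Y ω j) * g (Y ω) ∂μ = ∫ ω, V ω * g (Y ω) ∂μ := by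
    rw [← integral_condExp hle, hVdef]
    exact integral_congr_ae (condExp_mul_of_stronglyMeasurable_right hgY hDg hD)
  have hVi : Integrable V μ := hV.integrable one_le_two
  have hVg : Integrable (fun ω => V ω * g (Y ω)) μ :=
    hVi.mul_bdd (c := M) hgYm (ae_of_all _ fun ω => hgM _)
  have hgi : Integrable (fun ω => g (Y ω)) μ := Integrable.of_bound hgYm M
    (ae_of_all _ fun ω => hgM _)
  have e3 : ∫ ω, (V ω - ∫ ω, V ω ∂μ) * g (Y ω) ∂μ =
      ∫ ω, V ω * g (Y ω) ∂μ - (∫ ω, V ω ∂μ) * ∫ ω, g (Y ω) ∂μ := by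
    simp_rw [sub_mul]
    rw [integral_sub hVg (hgi.const_mul _), integral_const_mul]
  rw [e1, e2, abs_sub_comm, ← e3, variance_eq_integral hV.aemeasurable]
  exact abs_integral_mul_le_mul_sqrt hM (hV.sub (memLp_const _)) hgYm (fun ω => hgM _)

/-- The Stein identity for a normalized exchangeable pair, with explicit error terms. -/
lemma abs_integral_stein_le (hY : IsNormalizedPair μ Y Y' ρ P)
    (hV : ∀ i j,
      MemLp (μ[fun ω => (Y' ω i - Y ω i) * (Y' ω j - Y ω j) | sig Y]) 2 μ)
    (h3 : ∀ i j k, Integrable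
      (fun ω => (Y' ω i - Y ω i) * (Y' ω j - Y ω j) * (Y' ω k - Y ω k)) μ)
    {g : Fin d → Vec d → ℝ} {gd : Fin d → Fin d → Vec d → ℝ} {c M₁ M₂ M₃ : ℝ}
    (hg : ∀ m, Measurable (g m)) (hgd : ∀ m j, Measurable (gd m j))
    (hM₁ : 0 ≤ M₁) (hM₂ : 0 ≤ M₂)
    (hg1 : ∀ m x, |g m x| ≤ M₁) (hg2 : ∀ m j x, |gd m j x| ≤ M₂)
    (htaylor : ∀ m x w, |g m (x + w) - g m x - c * ∑ j, w j * gd m j x|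
      ≤ M₃ * ∑ j, ∑ k, |w j * w k|) :
    |∫ ω, ∑ m, (c * gd m m (Y ω) - Y ω m * g m (Y ω)) ∂μ| ≤
      ∑ i, (∑ m, |P m i|) * (∑ j, |c| * (M₂ / 2 *
          √(variance (μ[fun ω => (Y' ω i - Y ω i) * (Y' ω j - Y ω j) | sig Y]) μ)
          + M₂ * √(∫ ω, ρ ω i ^ 2 ∂μ))
        + M₃ / 2 * ∑ j, ∑ k, ∫ ω, |(Y' ω i - Y ω i) * (Y' ω j - Y ω j) * (Y' ω k - Y ω k)| ∂μ
        + M₁ * √(∫ ω, ρ ω i ^ 2 ∂μ)) := by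
  have mY := hY.measurable_left
  have mY' := hY.measurable_right
  set Δ : Fin d → Ω → ℝ := fun i ω => Y' ω i - Y ω i with hΔ
  -- First order Taylor remainder; multiplied by Δ_i it is controlled by third absolute moments,
  -- which give B'.
  set rem : Fin d → Ω → ℝ := fun m ω => g m (Y' ω) - g m (Y ω) - c * ∑ j, Δ j ω * gd m j (Y ω)
    with hrem
  have hgY : ∀ m, AEStronglyMeasurable (fun ω => g m (Y ω)) μ :=
    fun m => ((hg m).comp mY).aestronglyMeasurable
  have hgY' : ∀ m, AEStronglyMeasurable (fun ω => g m (Y' ω)) μ :=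
    fun m => ((hg m).comp mY').aestronglyMeasurable
  have hgdY : ∀ m j, AEStronglyMeasurable (fun ω => gd m j (Y ω)) μ :=
    fun m j => ((hgd m j).comp mY).aestronglyMeasurable
  have hΔi : ∀ i, Integrable (Δ i) μ := fun i => (hY.memLp_incr i).integrable one_le_two
  have hΔg : ∀ i m, Integrable (fun ω => Δ i ω * g m (Y ω)) μ := fun i m =>
    (hΔi i).mul_bdd (c := M₁) (hgY m) (ae_of_all _ fun ω => hg1 m _)
  have hΔg' : ∀ i m, Integrable (fun ω => Δ i ω * g m (Y' ω)) μ := fun i m =>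
    (hΔi i).mul_bdd (c := M₁) (hgY' m) (ae_of_all _ fun ω => hg1 m _)
  have hΔΔ : ∀ i j, Integrable (fun ω => Δ i ω * Δ j ω) μ := fun i j =>
    (hY.memLp_incr i).integrable_mul (hY.memLp_incr j)
  have hΔΔg : ∀ i j m, Integrable (fun ω => Δ i ω * Δ j ω * gd m j (Y ω)) μ := fun i j m =>
    (hΔΔ i j).mul_bdd (c := M₂) (hgdY m j) (ae_of_all _ fun ω => hg2 m j _)
  have hremeq : ∀ i m, (fun ω => Δ i ω * rem m ω) = fun ω => Δ i ω * g m (Y' ω)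
      - Δ i ω * g m (Y ω) - c * ∑ j, Δ i ω * Δ j ω * gd m j (Y ω) := by
    intro i m
    ext ω
    have : ∑ j, Δ i ω * Δ j ω * gd m j (Y ω) = Δ i ω * ∑ j, Δ j ω * gd m j (Y ω) := by
      rw [Finset.mul_sum]
      exact Finset.sum_congr rfl fun j _ => by ring
    rw [this, hrem]
    ring
  have hsum : ∀ i m, Integrable (fun ω => ∑ j, Δ i ω * Δ j ω * gd m j (Y ω)) μ := fun i m =>
    integrable_finsetSum _ fun j _ => hΔΔg i j m
  have hrem_int : ∀ i m, ∫ ω, Δ i ω * rem m ω ∂μ = ∫ ω, Δ i ω * g m (Y' ω) ∂μ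
      - ∫ ω, Δ i ω * g m (Y ω) ∂μ - c * ∑ j, ∫ ω, Δ i ω * Δ j ω * gd m j (Y ω) ∂μ := by
    intro i m
    have hd : Integrable (fun ω => Δ i ω * g m (Y' ω) - Δ i ω * g m (Y ω)) μ :=
      (hΔg' i m).sub (hΔg i m)
    rw [hremeq, integral_sub hd ((hsum i m).const_mul c), integral_sub (hΔg' i m) (hΔg i m),
      integral_const_mul, integral_finsetSum _ fun j _ => hΔΔg i j m]
  have hanti : ∀ i m, ∫ ω, Δ i ω * g m (Y' ω) ∂μ + ∫ ω, Δ i ω * g m (Y ω) ∂μ = 0 := by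
    intro i m
    rw [← integral_add (hΔg' i m) (hΔg i m), ← hY.integral_incr_mul_add i (hg m)]
    simp only [mul_add, hΔ]
  have hrem_le : ∀ i m, |∫ ω, Δ i ω * rem m ω ∂μ| ≤
      M₃ * ∑ j, ∑ k, ∫ ω, |Δ i ω * Δ j ω * Δ k ω| ∂μ := by
    intro i m
    have hint : Integrable (fun ω => M₃ * ∑ j, ∑ k, |Δ i ω * Δ j ω * Δ k ω|) μ :=
      (integrable_finsetSum _ fun j _ => integrable_finsetSum _ fun k _ =>
        (h3 i j k).abs).const_mul _
    have e : ∫ ω, M₃ * ∑ j, ∑ k, |Δ i ω * Δ j ω * Δ k ω| ∂μ =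
        M₃ * ∑ j, ∑ k, ∫ ω, |Δ i ω * Δ j ω * Δ k ω| ∂μ := by
      rw [integral_const_mul, integral_finsetSum _ fun j _ => integrable_finsetSum _ fun k _ =>
        (h3 i j k).abs]
      congr 1
      exact Finset.sum_congr rfl fun j _ => integral_finsetSum _ fun k _ => (h3 i j k).abs
    rw [← e]
    refine norm_integral_le_of_norm_le (f := fun ω => Δ i ω * rem m ω) hint (ae_of_all _ fun ω => ?_)
    have ht := htaylor m (Y ω) (Y' ω - Y ω)
    rw [add_sub_cancel] at ht
    have ht' : |rem m ω| ≤ M₃ * ∑ j, ∑ k, |Δ j ω * Δ k ω| := ht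
    rw [Real.norm_eq_abs, abs_mul]
    refine (mul_le_mul_of_nonneg_left ht' (abs_nonneg _)).trans_eq ?_
    rw [mul_left_comm]
    congr 1
    simp only [Finset.mul_sum, abs_mul, mul_assoc]
  have hreg := fun m => hY.regression m (g m) (hg m)
    (MemLp.of_bound (hgY m) M₁ (ae_of_all _ fun ω => hg1 m _))
  have hYg : ∀ m, Integrable (fun ω => Y ω m * g m (Y ω)) μ := fun m =>
    ((hY.memLp_left m).integrable one_le_two).mul_bdd (c := M₁) (hgY m)
      (ae_of_all _ fun ω => hg1 m _)
  have hgdi : ∀ m j, Integrable (fun ω => gd m j (Y ω)) μ := fun m j =>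
    Integrable.of_bound (hgdY m j) M₂ (ae_of_all _ fun ω => hg2 m j _)
  have hterm : ∀ m, Integrable (fun ω => c * gd m m (Y ω) - Y ω m * g m (Y ω)) μ := fun m =>
    ((hgdi m m).const_mul c).sub (hYg m)
  set K : Fin d → Fin d → ℝ := fun m j => ∫ ω, gd m j (Y ω) ∂μ with hK
  set E : Fin d → Fin d → ℝ := fun i j => ∫ ω, Δ i ω * Δ j ω ∂μ with hE
  set r : Fin d → Fin d → ℝ := fun i j => ∫ ω, ρ ω i * Y ω j ∂μ with hr
  set Q : Fin d → Fin d → Fin d → ℝ := fun i m j => ∫ ω, Δ i ω * Δ j ω * gd m j (Y ω) ∂μ with hQ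
  -- The error multiplying P_{mi}: a covariance error (A'), a remainder correction to the covariance
  -- identity (C' d), the Taylor error (B'), and the regression remainder (C').
  set br : Fin d → Fin d → ℝ := fun m i =>
    ∑ j, c * (1 / 2 * (E i j * K m j - Q i m j) + r i j * K m j)
      - 1 / 2 * ∫ ω, Δ i ω * rem m ω ∂μ - ∫ ω, ρ ω i * g m (Y ω) ∂μ with hbr
  have main : ∀ m, ∫ ω, (c * gd m m (Y ω) - Y ω m * g m (Y ω)) ∂μ = ∑ i, P m i * br m i := by
    intro m
    rw [integral_sub ((hgdi m m).const_mul c) (hYg m), integral_const_mul]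
    -- The diagonal term is written with a Kronecker delta, which the covariance identity expands
    -- into moments of the increments and the remainder.
    have t1 : c * K m m = ∑ i, P m i * ∑ j, c * (1 / 2 * (E i j * K m j) + r i j * K m j) := by
      have s1 : c * K m m = ∑ j, c * (if m = j then 1 else 0) * K m j := by
        simp
      rw [s1]
      simp_rw [← hY.sum_mul_cov_incr m, Finset.mul_sum, Finset.sum_mul]
      rw [Finset.sum_comm]
      refine Finset.sum_congr rfl fun i _ => Finset.sum_congr rfl fun j _ => ?_
      simp only [hE, hr, hΔ]
      ring
    -- Regression expresses the left side through E Δ_i g_m(Y); antisymmetry and the Taylor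
    -- expansion rewrite that as -½ times second order moments plus the remainder.
    have t2 : ∫ ω, Y ω m * g m (Y ω) ∂μ = ∑ i, P m i *
        (∑ j, c * (1 / 2 * Q i m j) + 1 / 2 * ∫ ω, Δ i ω * rem m ω ∂μ
          + ∫ ω, ρ ω i * g m (Y ω) ∂μ) := by
      have s2 : ∫ ω, Y ω m * g m (Y ω) ∂μ = ∑ i, P m i * (-∫ ω, Δ i ω * g m (Y ω) ∂μ
          + ∫ ω, ρ ω i * g m (Y ω) ∂μ) := by
        simp_rw [mul_add, Finset.sum_add_distrib, mul_neg, Finset.sum_neg_distrib]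
        linarith [hreg m]
      rw [s2]
      refine Finset.sum_congr rfl fun i _ => ?_
      congr 2
      have s3 : ∑ j, c * (1 / 2 * Q i m j) = 1 / 2 * (c * ∑ j, Q i m j) := by
        simp only [Finset.mul_sum]
        exact Finset.sum_congr rfl fun j _ => by ring
      rw [s3]
      linarith [hrem_int i m, hanti i m]
    rw [t2, show c * ∫ ω, gd m m (Y ω) ∂μ = c * K m m from rfl, t1, ← Finset.sum_sub_distrib]
    refine Finset.sum_congr rfl fun i _ => ?_
    rw [← mul_sub, hbr]
    congr 1
    have s4 : ∑ j, c * (1 / 2 * (E i j * K m j - Q i m j) + r i j * K m j) =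
        ∑ j, c * (1 / 2 * (E i j * K m j) + r i j * K m j) - ∑ j, c * (1 / 2 * Q i m j) := by
      rw [← Finset.sum_sub_distrib]
      exact Finset.sum_congr rfl fun j _ => by ring
    simp only [s4]
    ring
  rw [integral_finsetSum _ fun m _ => hterm m]
  simp_rw [main]
  refine (Finset.abs_sum_le_sum_abs _ _).trans ?_
  simp_rw [Finset.sum_mul]
  rw [Finset.sum_comm]
  refine Finset.sum_le_sum fun m _ => (Finset.abs_sum_le_sum_abs _ _).trans
    (Finset.sum_le_sum fun i _ => ?_)
  rw [abs_mul]
  refine mul_le_mul_of_nonneg_left ?_ (abs_nonneg _)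
  refine (abs_sub _ _).trans (add_le_add ((abs_sub _ _).trans (add_le_add ?_ ?_)) ?_)
  · refine (Finset.abs_sum_le_sum_abs _ _).trans (Finset.sum_le_sum fun j _ => ?_)
    rw [abs_mul]
    refine mul_le_mul_of_nonneg_left ((abs_add_le _ _).trans (add_le_add ?_ ?_)) (abs_nonneg _)
    · have := hY.abs_cov_sub_le i j rfl (hV i j) (hgd m j) hM₂ (hg2 m j)
      rw [abs_mul, abs_of_nonneg (by norm_num : (0 : ℝ) ≤ 1 / 2)]
      have h' : |E i j * K m j - Q i m j| ≤ M₂ *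
        √(variance (μ[fun ω => Δ i ω * Δ j ω | sig Y]) μ) := this
      linarith
    · rw [abs_mul, mul_comm]
      refine mul_le_mul ?_ (hY.abs_integral_remainder_mul_coord_le i j) (abs_nonneg _) hM₂
      have := norm_integral_le_of_norm_le_const (μ := μ) (f := fun ω => gd m j (Y ω))
        (ae_of_all _ fun ω => hg2 m j _)
      simpa using this
  · rw [abs_mul, abs_of_nonneg (by norm_num : (0 : ℝ) ≤ 1 / 2)]
    linarith [hrem_le i m]
  · exact abs_integral_mul_le_mul_sqrt hM₁ (hY.memLp_remainder i) (hgY m) (fun ω => hg1 m _)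

end IsNormalizedPair

end ExchPair

/-! ### Standardization of a Stein pair. -/

namespace ExchPair

variable {d : ℕ}

lemma app_apply (M : Mat d) (x : Vec d) (i : Fin d) : app M x i = ∑ k, M i k * x k := by
  rw [app, Matrix.ofLp_toEuclideanCLM]
  rfl

lemma app_mul (M N : Mat d) (x : Vec d) : app (M * N) x = app M (app N x) := by
  simp [app]

lemma app_one (x : Vec d) : app (1 : Mat d) x = x := by
  simp [app]

lemma sqrt_mul_sqrt_of_posDef {S : Mat d} (hS : S.PosDef) : CFC.sqrt S * CFC.sqrt S = S :=
  CFC.sqrt_mul_sqrt_self S hS.posSemidef.nonneg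

lemma isUnit_det_sqrt {S : Mat d} (hS : S.PosDef) : IsUnit (CFC.sqrt S).det := by
  have h := (Matrix.isUnit_iff_isUnit_det S).1 hS.isUnit
  rw [← sqrt_mul_sqrt_of_posDef hS, Matrix.det_mul] at h
  exact isUnit_of_mul_isUnit_left h

lemma inv_sqrt_mul_sqrt {S : Mat d} (hS : S.PosDef) : (CFC.sqrt S)⁻¹ * CFC.sqrt S = 1 :=
  Matrix.nonsing_inv_mul _ (isUnit_det_sqrt hS)

lemma sqrt_mul_inv_sqrt {S : Mat d} (hS : S.PosDef) : CFC.sqrt S * (CFC.sqrt S)⁻¹ = 1 :=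
  Matrix.mul_nonsing_inv _ (isUnit_det_sqrt hS)

lemma inv_sqrt_mul_mul_transpose {S : Mat d} (hS : S.PosDef) :
    (CFC.sqrt S)⁻¹ * S * (CFC.sqrt S)⁻¹ᵀ = 1 := by
  have h1 : (CFC.sqrt S)ᵀ = CFC.sqrt S := by
    have := (CFC.sqrt_nonneg S).isSelfAdjoint
    rw [IsSelfAdjoint, Matrix.star_eq_conjTranspose] at this
    rwa [Matrix.conjTranspose_eq_transpose_of_trivial] at this
  rw [Matrix.transpose_nonsing_inv, h1]
  calc (CFC.sqrt S)⁻¹ * S * (CFC.sqrt S)⁻¹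
      = ((CFC.sqrt S)⁻¹ * CFC.sqrt S) * (CFC.sqrt S * (CFC.sqrt S)⁻¹) := by
        simp only [Matrix.mul_assoc]
        rw [← Matrix.mul_assoc (CFC.sqrt S) (CFC.sqrt S), sqrt_mul_sqrt_of_posDef hS]
    _ = 1 := by rw [inv_sqrt_mul_sqrt hS, sqrt_mul_inv_sqrt hS, one_mul]

lemma standardize_apply {Ω : Type*} {S : Mat d} (X : Ω → Vec d) (ω : Ω) (i : Fin d) :
    standardize S X ω i = ∑ k, (CFC.sqrt S)⁻¹ i k * X ω k := app_apply _ _ _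

variable {Ω : Type*} [MeasurableSpace Ω] {μ : Measure Ω} {W W' R : Ω → Vec d} {S L : Mat d}

lemma memLp_standardize {X : Ω → Vec d} (hX : ∀ i, MemLp (fun ω => X ω i) 2 μ) (i : Fin d) :
    MemLp (fun ω => standardize S X ω i) 2 μ := by
  simp_rw [standardize_apply]
  exact memLp_finsetSum _ fun k _ => (hX k).const_mul _

/-- Standardization turns a Stein pair into a normalized exchangeable pair. -/
lemma IsSteinPair.isNormalizedPair [IsProbabilityMeasure μ] (h : IsSteinPair μ W W' R S L) :
    IsNormalizedPair μ (standardize S W) (standardize S W') (standardize S R)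
      ((CFC.sqrt S)⁻¹ * L⁻¹ * CFC.sqrt S) := by
  have mW := h.measurable_left
  have mW' := h.measurable_right
  have hle : sig W ≤ ‹MeasurableSpace Ω› := mW.comap_le
  set N := (CFC.sqrt S)⁻¹ with hN
  have hN1 : CFC.sqrt S * N = 1 := sqrt_mul_inv_sqrt h.posDef
  have mapp : ∀ M : Mat d, Measurable (fun x : Vec d => app M x) := fun M =>
    (Matrix.toEuclideanCLM (𝕜 := ℝ) M).continuous.measurable
  have lW : ∀ i, MemLp (fun ω => W ω i) 2 μ := fun i => by
    refine h.memLp.mono (by fun_prop) (ae_of_all _ fun ω => ?_)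
    exact abs_coord_le_norm (W ω) i
  have hmap : μ.map W' = μ.map W := by
    have := congrArg (Measure.map Prod.snd) h.exchangeable
    rw [Measure.map_map (by fun_prop) (by fun_prop), Measure.map_map (by fun_prop) (by fun_prop)]
      at this
    exact this
  have lW' : ∀ i, MemLp (fun ω => W' ω i) 2 μ := fun i => by
    have hm : Measurable fun x : Vec d => x i := by fun_prop
    have := lW i
    rw [show (fun ω => W ω i) = (fun x : Vec d => x i) ∘ W from rfl,
      ← memLp_map_measure_iff hm.aestronglyMeasurable mW.aemeasurable, ← hmap,
      memLp_map_measure_iff hm.aestronglyMeasurable mW'.aemeasurable] at this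
    exact this
  have lD : ∀ i, MemLp (fun ω => W' ω i - W ω i) 2 μ := fun i => (lW' i).sub (lW i)
  have lLW : ∀ i, MemLp (fun ω => app L (W ω) i) 2 μ := fun i => by
    simp_rw [app_apply]
    exact memLp_finsetSum _ fun k _ => (lW k).const_mul _
  -- The remainder is almost surely E^W(W' - W) + ΛW, a sum of square integrable vectors.
  have lR : ∀ i, MemLp (fun ω => R ω i) 2 μ := fun i => by
    refine (((lD i).condExp (m := sig W) one_le_two).add (lLW i)).ae_eq ?_
    filter_upwards [h.regression i] with ω hω
    simp [hω]
  refine ⟨(mapp N).comp mW, (mapp N).comp mW', ?_, memLp_standardize lW, memLp_standardize lR,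
    ?_, ?_⟩
  · have e := congrArg (Measure.map (Prod.map (fun x : Vec d => app N x) (fun x => app N x)))
      h.exchangeable
    rw [Measure.map_map ((mapp N).prodMap (mapp N)) (by fun_prop),
      Measure.map_map ((mapp N).prodMap (mapp N)) (by fun_prop)] at e
    exact e
  · intro i j
    have e : ∀ ω, standardize S W ω i * standardize S W ω j =
        ∑ k, ∑ l, N i k * N j l * (W ω k * W ω l) := by
      intro ω
      rw [standardize_apply, standardize_apply, Finset.sum_mul_sum]
      refine Finset.sum_congr rfl fun k _ => Finset.sum_congr rfl fun l _ => ?_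
      ring
    have hi : ∀ k l, Integrable (fun ω => N i k * N j l * (W ω k * W ω l)) μ := fun k l =>
      ((lW k).integrable_mul (lW l)).const_mul _
    simp_rw [e]
    rw [integral_finsetSum _ fun k _ => integrable_finsetSum _ fun l _ => hi k l]
    simp_rw [integral_finsetSum _ fun l _ => hi _ l, integral_const_mul, h.cov]
    have := congrFun (congrFun (inv_sqrt_mul_mul_transpose h.posDef) i) j
    rw [Matrix.one_apply] at this
    rw [← this]
    simp only [Matrix.mul_apply, Matrix.transpose_apply, Finset.sum_mul, ← hN]
    rw [Finset.sum_comm]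
    refine Finset.sum_congr rfl fun k _ => Finset.sum_congr rfl fun l _ => ?_
    ring
  · intro m G hG hG2
    have hGW : StronglyMeasurable[sig W] (fun ω => G (standardize S W ω)) :=
      ((hG.comp (mapp N)).comp (comap_measurable W)).stronglyMeasurable
    set H : Ω → ℝ := fun ω => G (standardize S W ω) with hH
    set D : Fin d → ℝ := fun k => ∫ ω, (W' ω k - W ω k) * H ω ∂μ with hD
    set w : Fin d → ℝ := fun k => ∫ ω, W ω k * H ω ∂μ with hw
    set r : Fin d → ℝ := fun k => ∫ ω, R ω k * H ω ∂μ with hr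
    have hstd : ∀ (X : Ω → Vec d), (∀ k, MemLp (fun ω => X ω k) 2 μ) → ∀ i,
        ∫ ω, standardize S X ω i * H ω ∂μ = (N *ᵥ fun k => ∫ ω, X ω k * H ω ∂μ) i := by
      intro X hX i
      simp_rw [standardize_apply, Finset.sum_mul, mul_assoc]
      have hi : ∀ k, Integrable (fun ω => N i k * (X ω k * H ω)) μ := fun k =>
        ((hX k).integrable_mul hG2).const_mul _
      rw [integral_finsetSum _ fun k _ => hi k]
      simp [Matrix.mulVec, dotProduct, integral_const_mul]
    have hDeq : D = -(L *ᵥ w) + r := by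
      ext k
      have i1 : Integrable (fun ω => (W' ω k - W ω k) * H ω) μ := (lD k).integrable_mul hG2
      have i2 : Integrable (fun ω => app L (W ω) k * H ω) μ := (lLW k).integrable_mul hG2
      have i3 : Integrable (fun ω => R ω k * H ω) μ := (lR k).integrable_mul hG2
      have c1 := condExp_mul_of_stronglyMeasurable_right hGW i1 ((lD k).integrable one_le_two)
      have e1 : D k = ∫ ω, (-(app L (W ω) k) + R ω k) * H ω ∂μ := by
        rw [hD]
        simp only
        rw [← integral_condExp hle]
        refine integral_congr_ae ?_
        filter_upwards [c1, h.regression k] with ω h1 h2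
        rw [← h2]
        exact h1
      have e2 : ∫ ω, app L (W ω) k * H ω ∂μ = (L *ᵥ w) k := by
        simp_rw [app_apply, Finset.sum_mul, mul_assoc]
        have hi : ∀ l, Integrable (fun ω => L k l * (W ω l * H ω)) μ := fun l =>
          ((lW l).integrable_mul hG2).const_mul _
        rw [integral_finsetSum _ fun l _ => hi l]
        simp [Matrix.mulVec, dotProduct, integral_const_mul, hw]
      rw [e1]
      simp_rw [add_mul, neg_mul]
      have i4 : Integrable (fun ω => -(app L (W ω) k * H ω)) μ := i2.neg
      rw [integral_add i4 i3, integral_neg, e2]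
      rfl
    have hincr : ∀ i, ∫ ω, (standardize S W' ω i - standardize S W ω i) * H ω ∂μ =
        (N *ᵥ D) i := by
      intro i
      have i1 : Integrable (fun ω => standardize S W' ω i * H ω) μ :=
        (memLp_standardize lW' i).integrable_mul hG2
      have i2 : Integrable (fun ω => standardize S W ω i * H ω) μ :=
        (memLp_standardize lW i).integrable_mul hG2
      simp_rw [sub_mul]
      rw [integral_sub i1 i2, hstd W' lW', hstd W lW, ← Pi.sub_apply, ← Matrix.mulVec_sub]
      congr 2
      ext k
      have i3 : Integrable (fun ω => W' ω k * H ω) μ := (lW' k).integrable_mul hG2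
      have i4 : Integrable (fun ω => W ω k * H ω) μ := (lW k).integrable_mul hG2
      simp only [Pi.sub_apply, hD, sub_mul]
      rw [integral_sub i3 i4]
    have hLinv : L⁻¹ * L = 1 :=
      Matrix.nonsing_inv_mul _ ((Matrix.isUnit_iff_isUnit_det L).1 h.invertible)
    -- The factor S^{1/2} cancels the standardization of the increments and of R, and then Λ⁻¹
    -- inverts the original regression.
    have s1 : ∀ v : Fin d → ℝ, ∑ i, (N * L⁻¹ * CFC.sqrt S) m i * (N *ᵥ v) i =
        ((N * L⁻¹) *ᵥ v) m := by
      intro v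
      change ((N * L⁻¹ * CFC.sqrt S) *ᵥ (N *ᵥ v)) m = _
      rw [Matrix.mulVec_mulVec, Matrix.mul_assoc (N * L⁻¹), hN1, mul_one]
    have e1 : ∑ i, (N * L⁻¹ * CFC.sqrt S) m i *
        ∫ ω, (standardize S W' ω i - standardize S W ω i) * H ω ∂μ = ((N * L⁻¹) *ᵥ D) m := by
      rw [← s1]
      exact Finset.sum_congr rfl fun i _ => by rw [hincr]
    have e2 : ∑ i, (N * L⁻¹ * CFC.sqrt S) m i * ∫ ω, standardize S R ω i * H ω ∂μ =
        ((N * L⁻¹) *ᵥ r) m := by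
      rw [← s1]
      exact Finset.sum_congr rfl fun i _ => by rw [hstd R lR]
    refine e1.trans ?_
    refine Eq.trans ?_ (congrArg₂ (fun a b => -a + b) (hstd W lW m) e2).symm
    rw [hDeq, Matrix.mulVec_add, Matrix.mulVec_neg, Matrix.mulVec_mulVec, Matrix.mul_assoc, hLinv,
      mul_one]
    rfl

end ExchPair

/-! ### Comparison of the smoothed law with the normal law. -/

namespace ExchPair

variable {d : ℕ}

/-- A bound on the difference of two laws tested on smooth functions extends to Borel functions. -/
lemma abs_integral_sub_le_of_smooth {ν₁ ν₂ : Measure (Vec d)} [IsProbabilityMeasure ν₁]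
    [IsProbabilityMeasure ν₂] {K : ℝ}
    (hK : ∀ h : Vec d → ℝ, IsSmoothCompact h → (∀ x, |h x| ≤ 1) →
      |∫ x, h x ∂ν₁ - ∫ x, h x ∂ν₂| ≤ K)
    {h : Vec d → ℝ} (hm : Measurable h) (h1 : ∀ x, |h x| ≤ 1) :
    |∫ x, h x ∂ν₁ - ∫ x, h x ∂ν₂| ≤ K := by
  have hK0 : 0 ≤ K := (abs_nonneg _).trans
    (hK (fun _ => 0) ⟨contDiff_const, HasCompactSupport.zero⟩ (by simp))
  have main : ∀ ε : ℝ, 0 < ε → |∫ x, h x ∂ν₁ - ∫ x, h x ∂ν₂| ≤ K + ε * (K + 3) := by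
    intro ε hε
    have hi : Integrable h (ν₁ + ν₂) :=
      Integrable.of_bound hm.aestronglyMeasurable 1 (ae_of_all _ h1)
    -- Approximating in L¹(ν₁ + ν₂) controls the error under both laws at once. Truncating to [-1,
    -- 1] does not increase the error, and dividing the smooth approximation by 1 + ε restores the
    -- sup bound.
    obtain ⟨f, hf, hfh, hfc, hfi⟩ := hi.exists_hasCompactSupport_integral_sub_le hε
    set φ : ℝ → ℝ := fun t => max (-1) (min 1 t) with hφ
    have hφf : HasCompactSupport (φ ∘ f) := hf.comp_left (by simp [hφ])
    have hφ1 : ∀ t, |φ t| ≤ 1 := fun t =>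
      abs_le.2 ⟨le_max_left _ _, max_le (by norm_num) (min_le_left _ _)⟩
    have hφc : Continuous (φ ∘ f) := by
      simp only [hφ, Function.comp_def]
      fun_prop
    have hφh : ∀ x, |h x - φ (f x)| ≤ |h x - f x| := by
      intro x
      obtain ⟨l, u⟩ := abs_le.1 (h1 x)
      have e : h x = φ (h x) := by simp [hφ, l, u]
      conv_lhs => rw [e]
      have a1 := abs_max_sub_max_le_max (-1) (min 1 (h x)) (-1) (min 1 (f x))
      have a2 := abs_min_sub_min_le_max 1 (h x) 1 (f x)
      rw [sub_self, abs_zero] at a1 a2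
      exact (a1.trans_eq (max_eq_right (abs_nonneg _))).trans
        (a2.trans_eq (max_eq_right (abs_nonneg _)))
    obtain ⟨g, hg, hgf, hgs⟩ := hφc.exists_contDiff_approx (ε := fun _ => ε) ⊤ (by fun_prop)
      (fun _ => hε)
    have hgcs : HasCompactSupport g := hφf.mono hgs
    have hgsc : IsSmoothCompact (fun x => (1 + ε)⁻¹ * g x) :=
      ⟨contDiff_const.mul hg, hgcs.mul_left⟩
    have hg1 : ∀ x, |g x| ≤ 1 + ε := by
      intro x
      have e1 := hgf x
      rw [Real.dist_eq] at e1
      have e2 := abs_sub_abs_le_abs_sub (g x) ((φ ∘ f) x)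
      have e3 := hφ1 (f x)
      simp only [Function.comp_apply] at e1 e2
      linarith
    have hgK := hK _ hgsc (fun x => by
      rw [abs_mul, abs_of_pos (by positivity), inv_mul_le_iff₀ (by positivity), mul_one]
      exact hg1 x)
    rw [integral_const_mul, integral_const_mul, ← mul_sub, abs_mul, abs_of_pos (by positivity),
      inv_mul_le_iff₀ (by positivity)] at hgK
    have hgi : ∀ ν : Measure (Vec d), [IsProbabilityMeasure ν] → Integrable g ν := fun ν _ =>
      Integrable.of_bound hg.continuous.aestronglyMeasurable (1 + ε) (ae_of_all _ hg1)
    have hhi : ∀ ν : Measure (Vec d), [IsProbabilityMeasure ν] → Integrable h ν := fun ν _ =>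
      Integrable.of_bound hm.aestronglyMeasurable 1 (ae_of_all _ h1)
    have hdi : Integrable (fun x => ‖h x - f x‖) (ν₁ + ν₂) := (hi.sub hfi).norm
    have hcl : ∀ ν : Measure (Vec d), [IsProbabilityMeasure ν] →
        Integrable (fun x => ‖h x - f x‖) ν →
        |∫ x, h x ∂ν - ∫ x, g x ∂ν| ≤ ∫ x, ‖h x - f x‖ ∂ν + ε := by
      intro ν _ hν
      rw [← integral_sub (hhi ν) (hgi ν)]
      have e : ∫ x, ‖h x - f x‖ ∂ν + ε = ∫ x, (‖h x - f x‖ + ε) ∂ν := by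
        rw [integral_add hν (integrable_const _)]
        simp
      rw [e]
      refine norm_integral_le_of_norm_le (f := fun x => h x - g x) (hν.add (integrable_const _))
        (ae_of_all _ fun x => ?_)
      have e1 := hgf x
      rw [Real.dist_eq] at e1
      have e2 := hφh x
      have e3 := abs_sub_le (h x) (φ (f x)) (g x)
      simp only [Function.comp_apply] at e1
      rw [abs_sub_comm] at e1
      simp only [Real.norm_eq_abs]
      linarith
    rw [integral_add_measure hdi.left_of_add_measure hdi.right_of_add_measure] at hfh
    have c1 := hcl ν₁ hdi.left_of_add_measure
    have c2 := hcl ν₂ hdi.right_of_add_measure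
    rw [abs_le] at *
    constructor <;> nlinarith
  by_contra! hlt
  have := main ((|∫ x, h x ∂ν₁ - ∫ x, h x ∂ν₂| - K) / (2 * (K + 3)))
    (div_pos (by linarith) (by linarith))
  have e : (|∫ x, h x ∂ν₁ - ∫ x, h x ∂ν₂| - K) / (2 * (K + 3)) * (K + 3) =
      (|∫ x, h x ∂ν₁ - ∫ x, h x ∂ν₂| - K) / 2 := by
    field_simp
  rw [e] at this
  linarith

section Nonneg

variable {Ω : Type*} [MeasurableSpace Ω] (μ : Measure Ω) (W W' R : Ω → Vec d) (S L : Mat d)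

lemma lam_nonneg (i : Fin d) : 0 ≤ lam S L i := Finset.sum_nonneg fun _ _ => abs_nonneg _

lemma A'_nonneg : 0 ≤ A' μ W W' S L := Finset.sum_nonneg fun i _ => Finset.sum_nonneg fun _ _ =>
  mul_nonneg (lam_nonneg S L i) (Real.sqrt_nonneg _)

lemma B'_nonneg : 0 ≤ B' μ W W' S L := Finset.sum_nonneg fun i _ => Finset.sum_nonneg fun _ _ =>
  Finset.sum_nonneg fun _ _ =>
    mul_nonneg (lam_nonneg S L i) (integral_nonneg fun _ => abs_nonneg _)

lemma C'_nonneg : 0 ≤ C' μ R S L := Finset.sum_nonneg fun i _ =>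
  mul_nonneg (lam_nonneg S L i) (Real.sqrt_nonneg _)

lemma D'_nonneg : 0 ≤ D' μ W W' R S L :=
  add_nonneg (div_nonneg (A'_nonneg μ W W' S L) zero_le_two)
    (mul_nonneg (C'_nonneg μ R S L) (Nat.cast_nonneg _))

end Nonneg

variable {Ω : Type*} [MeasurableSpace Ω] {μ : Measure Ω} [IsProbabilityMeasure μ]
  {W W' R : Ω → Vec d} {S L : Mat d}

/-- The Stein bound applied to averages of ∂_m h with the derivative bounds of orders s⁻¹, s⁻², s⁻³.
The terms A'/2 and C' d come with the same factor, which explains the combination D'. -/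
lemma IsSteinPair.abs_integral_gaussAvg_deriv_le (hW : IsSteinPair μ W W' R S L)
    (hf : FiniteTerms μ W W' S) {h : Vec d → ℝ} (hh : IsSmoothCompact h) (h1 : ∀ x, |h x| ≤ 1)
    {c s : ℝ} (hc : 0 ≤ c) (hs : 0 < s) :
    |s * ∫ y, ∑ m, (c * gaussAvg c s (pderiv m (pderiv m h)) y
        - y m * gaussAvg c s (pderiv m h) y) ∂(μ.map (standardize S W))| ≤
      momentBound d * (2 * D' μ W W' R S L * (c / s) + 3 / 2 * B' μ W W' S L * (c ^ 2 / s ^ 2)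
        + C' μ R S L) := by
  have hY := hW.isNormalizedPair
  have hm0 : (0 : ℝ) ≤ momentBound d := zero_le_one.trans one_le_momentBound
  have hst := hY.abs_integral_stein_le hf.variance hf.third
    (g := fun m => gaussAvg c s (pderiv m h))
    (gd := fun m j => gaussAvg c s (pderiv j (pderiv m h))) (c := c)
    (M₁ := momentBound d / s) (M₂ := 2 * momentBound d / s ^ 2)
    (M₃ := c ^ 2 * (3 * momentBound d / s ^ 3))
    (fun m => ((hh.partialDeriv m).continuous_gaussAvg c s).measurable)
    (fun m j => (((hh.partialDeriv m).partialDeriv j).continuous_gaussAvg c s).measurable)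
    (by positivity) (by positivity)
    (fun m x => hh.abs_gaussAvg_pderiv_le h1 hs m x)
    (fun m j x => hh.abs_gaussAvg_pderiv_pderiv_le h1 hs m j x)
    (fun m x w => (hh.partialDeriv m).abs_gaussAvg_taylor_le c s
      (fun j l x => hh.abs_gaussAvg_pderiv_pderiv_pderiv_le h1 hs m j l x) x w)
  have hmeas : Measurable fun y : Vec d => ∑ m, (c * gaussAvg c s (pderiv m (pderiv m h)) y
        - y m * gaussAvg c s (pderiv m h) y) := by
    refine Finset.measurable_sum _ fun m _ => ?_
    have e1 := ((hh.partialDeriv m).continuous_gaussAvg c s).measurable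
    have e2 := (((hh.partialDeriv m).partialDeriv m).continuous_gaussAvg c s).measurable
    fun_prop
  rw [integral_map hY.measurable_left.aemeasurable hmeas.aestronglyMeasurable, abs_mul,
    abs_of_pos hs]
  refine (mul_le_mul_of_nonneg_left hst hs.le).trans_eq ?_
  set V : Fin d → Fin d → ℝ := fun i j => √(variance (condProd μ S W W' i j) μ) with hV
  set r : Fin d → ℝ := fun i => √(∫ ω, (standardize S R ω i) ^ 2 ∂μ) with hr
  set τ : Fin d → Fin d → Fin d → ℝ := fun i j k =>
    ∫ ω, |incr S W W' i ω * incr S W W' j ω * incr S W W' k ω| ∂μ with hτ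
  set m := momentBound d with hm
  have hsum : s * ∑ i, lam S L i * (∑ j, |c| * (2 * m / s ^ 2 / 2 * V i j + 2 * m / s ^ 2 * r i)
        + c ^ 2 * (3 * m / s ^ 3) / 2 * ∑ j, ∑ k, τ i j k + m / s * r i) =
      m * (2 * D' μ W W' R S L * (c / s) + 3 / 2 * B' μ W W' S L * (c ^ 2 / s ^ 2)
        + C' μ R S L) := by
    have a1 : A' μ W W' S L = ∑ i, lam S L i * ∑ j, V i j := by
      simp only [A', Finset.mul_sum, hV]
    have a2 : B' μ W W' S L = ∑ i, lam S L i * ∑ j, ∑ k, τ i j k := by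
      simp only [B', Finset.mul_sum, hτ]
    have a3 : C' μ R S L = ∑ i, lam S L i * r i := rfl
    rw [D', a1, a2, a3, abs_of_nonneg hc]
    simp_rw [← Finset.mul_sum, Finset.sum_add_distrib, ← Finset.mul_sum]
    simp only [Finset.sum_const, Finset.card_univ, Fintype.card_fin, nsmul_eq_mul, mul_add,
      Finset.sum_add_distrib]
    have b1 : ∀ x y : ℝ, ∀ f : Fin d → ℝ, ∑ i, lam S L i * (x * (y * f i)) =
        x * y * ∑ i, lam S L i * f i := fun x y f => by
      rw [Finset.mul_sum]; exact Finset.sum_congr rfl fun i _ => by ring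
    have b3 : ∀ x : ℝ, ∀ f : Fin d → ℝ, ∑ i, lam S L i * (x * f i) =
        x * ∑ i, lam S L i * f i := fun x f => by
      rw [Finset.mul_sum]; exact Finset.sum_congr rfl fun i _ => by ring
    simp only [b1, b3]
    field_simp
  exact hsum

/-- The distance between the law of `c Y + s Z` and the standard normal distribution, tested on
smooth functions. -/
lemma IsSteinPair.abs_integral_gaussAvg_sub_le (hW : IsSteinPair μ W W' R S L)
    (hf : FiniteTerms μ W W' S) {h : Vec d → ℝ} (hh : IsSmoothCompact h) (h1 : ∀ x, |h x| ≤ 1)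
    {θ : ℝ} (hθ : 0 < θ) (hθ' : θ ≤ Real.pi / 2) :
    |∫ y, gaussAvg (Real.cos θ) (Real.sin θ) h y ∂(μ.map (standardize S W))
        - ∫ z, h z ∂(Phi d)| ≤
      2 * momentBound d * (-(D' μ W W' R S L) * Real.log (Real.sin θ)
        + B' μ W W' S L / Real.sin θ + C' μ R S L) := by
  have hY := hW.isNormalizedPair
  have hm1 : (1 : ℝ) ≤ momentBound d := one_le_momentBound
  have hB0 := B'_nonneg μ W W' S L
  have hC0 := C'_nonneg μ R S L
  set ν := μ.map (standardize S W) with hν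
  have : IsProbabilityMeasure ν := Measure.isProbabilityMeasure_map hY.measurable_left.aemeasurable
  have hνi : Integrable (fun y => ‖y‖) ν := by
    rw [hν, integrable_map_measure (by fun_prop) hY.measurable_left.aemeasurable]
    have hsum : Integrable (fun ω => ∑ i, |standardize S W ω i|) μ :=
      integrable_finsetSum _ fun i _ => ((hY.memLp_left i).integrable one_le_two).abs
    refine hsum.mono' (hY.measurable_left.norm.aestronglyMeasurable) (ae_of_all _ fun ω => ?_)
    simp only [Function.comp_apply, norm_norm]
    rw [EuclideanSpace.norm_eq, Real.sqrt_le_left (Finset.sum_nonneg fun _ _ => abs_nonneg _)]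
    exact Finset.sum_sq_le_sq_sum_of_nonneg fun i _ => abs_nonneg _
  set m := momentBound d
  set D := D' μ W W' R S L
  set B := B' μ W W' S L
  set C := C' μ R S L
  set F : ℝ → ℝ := fun θ => ∫ y, gaussAvg (Real.cos θ) (Real.sin θ) h y ∂ν with hF
  have hFd := hh.hasDerivAt_integral_gaussAvg hνi
  -- An antiderivative of the bound on |F'|, after cos² ≤ 1: log sin for cot, -cot for 1/sin², and t
  -- for 1.
  set G : ℝ → ℝ := fun t => m * (2 * D * Real.log (Real.sin t)
    - 3 / 2 * B * (Real.cos t / Real.sin t) + C * t) with hG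
  have hsin : ∀ t ∈ Set.Icc θ (Real.pi / 2), 0 < Real.sin t := fun t ht =>
    Real.sin_pos_of_pos_of_lt_pi (hθ.trans_le ht.1) (ht.2.trans_lt (by linarith [Real.pi_pos]))
  have hGd : ∀ t ∈ Set.Icc θ (Real.pi / 2), HasDerivAt G (m * (2 * D * (Real.cos t / Real.sin t)
      + 3 / 2 * B * (1 / Real.sin t ^ 2) + C)) t := by
    intro t ht
    have hst := (hsin t ht).ne'
    have e1 := ((Real.hasDerivAt_sin t).log hst).const_mul (2 * D)
    have e2 := ((Real.hasDerivAt_cos t).div (Real.hasDerivAt_sin t) hst).const_mul (3 / 2 * B)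
    refine (((e1.sub e2).add ((hasDerivAt_id t).const_mul C)).const_mul m).congr_deriv ?_
    have : -Real.sin t * Real.sin t - Real.cos t * Real.cos t = -1 := by
      nlinarith [Real.sin_sq_add_cos_sq t]
    rw [this]
    ring
  have hbd : ‖F (Real.pi / 2) - F θ‖ ≤ G (Real.pi / 2) - G θ := by
    refine image_norm_le_of_norm_deriv_right_le_deriv_boundary' (a := θ) (b := Real.pi / 2)
      (f := fun t => F t - F θ) (B := fun t => G t - G θ)
      (fun t _ => ((hFd t).sub_const _).continuousAt.continuousWithinAt)
      (fun t _ => ((hFd t).sub_const _).hasDerivWithinAt) (by simp)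
      (fun t ht => ((hGd t ht).sub_const _).continuousAt.continuousWithinAt)
      (fun t ht => ((hGd t (Set.Ico_subset_Icc_self ht)).sub_const _).hasDerivWithinAt)
      (fun t ht => ?_) (Set.right_mem_Icc.2 hθ')
    have ht' := Set.Ico_subset_Icc_self ht
    have hst := hsin t ht'
    refine (hW.abs_integral_gaussAvg_deriv_le hf hh h1
      (Real.cos_nonneg_of_mem_Icc ⟨by linarith [ht.1, Real.pi_pos], ht'.2⟩) hst).trans ?_
    have : Real.cos t ^ 2 / Real.sin t ^ 2 ≤ 1 / Real.sin t ^ 2 := by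
      gcongr
      nlinarith [Real.sin_sq_add_cos_sq t, sq_nonneg (Real.sin t)]
    gcongr
  have hFend : F (Real.pi / 2) = ∫ z, h z ∂(Phi d) := by
    simp [hF, gaussAvg]
  have hGend : G (Real.pi / 2) = m * (C * (Real.pi / 2)) := by
    simp [hG]
  rw [hFend, hGend, Real.norm_eq_abs, abs_sub_comm] at hbd
  refine hbd.trans ?_
  have hsθ := hsin θ (Set.left_mem_Icc.2 hθ')
  have hcot : Real.cos θ / Real.sin θ ≤ 1 / Real.sin θ := by
    gcongr
    exact Real.cos_le_one θ
  have e1 : B * (Real.cos θ / Real.sin θ) ≤ B / Real.sin θ := by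
    have := mul_le_mul_of_nonneg_left hcot hB0
    rwa [mul_one_div] at this
  have e2 : C * (Real.pi / 2) ≤ 2 * C := by
    have := mul_le_mul_of_nonneg_left (show Real.pi / 2 ≤ 2 by linarith [Real.pi_le_four]) hC0
    linarith
  have e3 : 0 ≤ C * θ := mul_nonneg hC0 hθ.le
  have e4 : 0 ≤ B / Real.sin θ := div_nonneg hB0 hsθ.le
  simp only [hG]
  have : m * (C * (Real.pi / 2)) - m * (2 * D * Real.log (Real.sin θ)
      - 3 / 2 * B * (Real.cos θ / Real.sin θ) + C * θ) =
      m * (C * (Real.pi / 2) - 2 * D * Real.log (Real.sin θ)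
        + 3 / 2 * (B * (Real.cos θ / Real.sin θ)) - C * θ) := by ring
  rw [this, show ∀ x : ℝ, 2 * m * x = m * (2 * x) from fun x => by ring]
  refine mul_le_mul_of_nonneg_left ?_ (by linarith)
  linarith

/-- The distance between the law of `c Y + s Z` and the standard normal distribution, tested on
bounded Borel functions. -/
lemma IsSteinPair.abs_integral_smoothed_sub_le (hW : IsSteinPair μ W W' R S L)
    (hf : FiniteTerms μ W W' S) {h : Vec d → ℝ} (hm : Measurable h) (h1 : ∀ x, |h x| ≤ 1)
    {θ : ℝ} (hθ : 0 < θ) (hθ' : θ ≤ Real.pi / 2) :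
    |∫ p, h (Real.cos θ • p.1 + Real.sin θ • p.2) ∂((μ.map (standardize S W)).prod (Phi d))
        - ∫ z, h z ∂(Phi d)| ≤
      2 * momentBound d * (-(D' μ W W' R S L) * Real.log (Real.sin θ)
        + B' μ W W' S L / Real.sin θ + C' μ R S L) := by
  have hY := hW.isNormalizedPair
  have : IsProbabilityMeasure (μ.map (standardize S W)) :=
    Measure.isProbabilityMeasure_map hY.measurable_left.aemeasurable
  have hu : Measurable (fun p : Vec d × Vec d => Real.cos θ • p.1 + Real.sin θ • p.2) := by
    fun_prop
  have : IsProbabilityMeasure (((μ.map (standardize S W)).prod (Phi d)).map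
      (fun p => Real.cos θ • p.1 + Real.sin θ • p.2)) :=
    Measure.isProbabilityMeasure_map hu.aemeasurable
  rw [← integral_map hu.aemeasurable hm.aestronglyMeasurable]
  -- Applied to the law of cos θ Y + sin θ Z and to Φ; the smooth estimate is uniform over functions
  -- bounded by 1.
  refine abs_integral_sub_le_of_smooth (fun g hg hg1 => ?_) hm h1
  rw [integral_map hu.aemeasurable hg.continuous.aestronglyMeasurable,
    integral_prod _ (hg.integrable_comp' (by fun_prop))]
  exact hW.abs_integral_gaussAvg_sub_le hf hg hg1 hθ hθ'

end ExchPair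

/-! ### The smoothing inequality for test classes. -/

namespace ExchPair

variable {d : ℕ}

section Envelope

variable {h : Vec d → ℝ} {δ : ℝ}

lemma bddAbove_upper (h1 : ∀ x, |h x| ≤ 1) (δ : ℝ) (x : Vec d) :
    BddAbove {r | ∃ y : Vec d, ‖y‖ ≤ δ ∧ r = h (x + y)} :=
  ⟨1, by rintro _ ⟨y, -, rfl⟩; exact (abs_le.1 (h1 _)).2⟩

lemma le_upper (h1 : ∀ x, |h x| ≤ 1) {x w : Vec d} (hxw : ‖w - x‖ ≤ δ) : h w ≤ upper h δ x :=
  le_csSup (bddAbove_upper h1 δ x) ⟨w - x, hxw, by rw [add_sub_cancel]⟩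

lemma lower_le (h1 : ∀ x, |h x| ≤ 1) (hδ : 0 ≤ δ) (x : Vec d) : lower h δ x ≤ h x :=
  csInf_le ⟨-1, by rintro _ ⟨y, -, rfl⟩; exact (abs_le.1 (h1 _)).1⟩
    ⟨0, by simpa using hδ, by rw [add_zero]⟩

lemma upper_le_upper (h1 : ∀ x, |h x| ≤ 1) (hδ : 0 ≤ δ) {x w : Vec d} (hxw : ‖w - x‖ ≤ δ) :
    upper h δ w ≤ upper h (2 * δ) x := by
  refine csSup_le ⟨_, 0, by simpa using hδ, rfl⟩ ?_
  rintro _ ⟨y, hy, rfl⟩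
  refine le_upper h1 ?_
  calc ‖w + y - x‖ = ‖(w - x) + y‖ := by congr 1; abel
    _ ≤ ‖w - x‖ + ‖y‖ := norm_add_le _ _
    _ ≤ 2 * δ := by linarith

lemma upper_neg (h : Vec d → ℝ) (δ : ℝ) (x : Vec d) :
    upper (fun y => -h y) δ x = -lower h δ x := by
  rw [upper, lower, Real.sInf_def, neg_neg]
  congr 1
  ext r
  simp only [Set.mem_ofPred_eq, Set.mem_neg, neg_eq_iff_eq_neg]

lemma lower_neg (h : Vec d → ℝ) (δ : ℝ) (x : Vec d) :
    lower (fun y => -h y) δ x = -upper h δ x := by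
  have := upper_neg (fun y => -h y) δ x
  simp only [neg_neg] at this
  rw [this, neg_neg]

end Envelope

/-- A test class need not be closed under negation, but its negatives form one: negation exchanges
the upper and lower envelopes. The other side of a one-sided bound follows from this. -/
lemma IsTestClass.neg {H : Set (Vec d → ℝ)} {a : ℝ} (hH : IsTestClass H a) :
    IsTestClass {h | (fun x => -h x) ∈ H} a where
  measurable h hh := by
    have := (hH.measurable _ hh).neg
    rwa [show (-fun x => -h x) = h from funext fun x => neg_neg _] at this
  bounded h hh x := by simpa using hH.bounded _ hh x
  upper_mem h hh δ hδ := by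
    have := hH.lower_mem _ hh δ hδ
    rwa [show lower (fun x => -h x) δ = fun x => -upper h δ x from
      funext fun x => lower_neg h δ x] at this
  lower_mem h hh δ hδ := by
    have := hH.upper_mem _ hh δ hδ
    rwa [show upper (fun x => -h x) δ = fun x => -lower h δ x from
      funext fun x => upper_neg h δ x] at this
  affine_mem h hh A b := hH.affine_mem _ hh A b
  one_le := hH.one_le
  oscillation δ hδ h hh := by
    have := hH.oscillation δ hδ _ hh
    simp_rw [upper_neg, lower_neg] at this
    refine le_trans (le_of_eq ?_) this
    congr 1
    ext x
    ring

lemma integrable_of_abs_le_one {α : Type*} [MeasurableSpace α] {μ : Measure α} [IsFiniteMeasure μ]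
    {f : α → ℝ} (hf : Measurable f) (h1 : ∀ x, |f x| ≤ 1) : Integrable f μ :=
  Integrable.of_bound hf.aestronglyMeasurable 1 (ae_of_all _ h1)

/-- Markov's inequality for |Z|², whose mean is d. -/
lemma measureReal_norm_gt_le {ρ : ℝ} (hρ : 0 < ρ) (hd : 4 * d ≤ ρ ^ 2) :
    (Phi d).real {z | ρ < ‖z‖} ≤ 1 / 4 := by
  have h := mul_meas_ge_le_integral_of_nonneg (μ := Phi d) (f := fun z : Vec d => ‖z‖ ^ 2)
    (ae_of_all _ fun z => sq_nonneg _) (integrable_norm_pow_stdGaussian 2) (ρ ^ 2)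
  rw [integral_norm_sq_stdGaussian] at h
  have h2 : (Phi d).real {z | ρ < ‖z‖} ≤ (Phi d).real {z : Vec d | ρ ^ 2 ≤ ‖z‖ ^ 2} := by
    refine measureReal_mono (fun z hz => ?_)
    have : ρ < ‖z‖ := hz
    simp only [Set.mem_ofPred_eq]
    gcongr
  have h3 : 0 < ρ ^ 2 := by positivity
  have h4 : ρ ^ 2 * (Phi d).real {z | ρ < ‖z‖} ≤ d :=
    (mul_le_mul_of_nonneg_left h2 h3.le).trans h
  by_contra! hlt
  nlinarith

/-- One-sided smoothing inequality. -/
lemma IsTestClass.integral_sub_le_of_smoothed {H : Set (Vec d → ℝ)} {a : ℝ}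
    (hH : IsTestClass H a) {ν : Measure (Vec d)} [IsProbabilityMeasure ν] {c s η κ ρ : ℝ}
    (hc : 0 < c) (hs : 0 < s) (hcs : c ^ 2 + s ^ 2 = 1)
    (hη : ∀ u : Vec d → ℝ, Measurable u → (∀ x, |u x| ≤ 1) →
      |∫ p, u (c • p.1 + s • p.2) ∂(ν.prod (Phi d)) - ∫ z, u z ∂(Phi d)| ≤ η)
    (hκ : ∀ h ∈ H, |∫ x, h x ∂ν - ∫ x, h x ∂(Phi d)| ≤ κ)
    (hρ : 0 < ρ) (hd : 4 * d ≤ ρ ^ 2) {h : Vec d → ℝ} (hh : h ∈ H) :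
    ∫ x, h x ∂ν - ∫ x, h x ∂(Phi d) ≤ 2 * a * ρ * (s / c) + κ / 3 + 4 / 3 * η := by
  have hη0 : 0 ≤ η := (abs_nonneg _).trans (hη (fun _ => 0) measurable_const (by simp))
  have hκ0 : 0 ≤ κ := (abs_nonneg _).trans (hκ h hh)
  set ε := s / c with hε
  have hε0 : 0 < ε := div_pos hs hc
  set δ := ε * ρ with hδ
  have hδ0 : 0 < δ := mul_pos hε0 hρ
  have h1 := hH.bounded h hh
  set u := upper h δ with hu
  have huH : u ∈ H := hH.upper_mem h hh δ hδ0
  have hum := hH.measurable u huH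
  have hu1 := hH.bounded u huH
  set u2 := upper h (2 * δ) with hu2
  have hu2H : u2 ∈ H := hH.upper_mem h hh (2 * δ) (by positivity)
  have hu2m := hH.measurable u2 hu2H
  have hu21 := hH.bounded u2 hu2H
  -- A - B compares ν with Φ on the shift of the upper envelope u by εz. Its mean over z is at most
  -- η, while pointwise lower bounds on it involve the quantity X to be estimated.
  set A : Vec d → ℝ := fun z => ∫ y, u (y + ε • z) ∂ν with hA
  set B : Vec d → ℝ := fun z => ∫ y, u (y + ε • z) ∂(Phi d) with hB
  have hsc : ∀ y z : Vec d, c⁻¹ • (c • y + s • z) = y + ε • z := by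
    intro y z
    rw [smul_add, smul_smul, smul_smul, inv_mul_cancel₀ hc.ne', one_smul, hε, div_eq_inv_mul]
  have hint : ∀ ν' : Measure (Vec d), [IsProbabilityMeasure ν'] →
      Integrable (fun p : Vec d × Vec d => u (p.1 + ε • p.2)) (ν'.prod (Phi d)) := fun ν' _ =>
    integrable_of_abs_le_one (by fun_prop) (fun _ => hu1 _)
  have e1 : ∀ ν' : Measure (Vec d), [IsProbabilityMeasure ν'] →
      ∫ p, u (c⁻¹ • (c • p.1 + s • p.2)) ∂(ν'.prod (Phi d)) =
        ∫ z, ∫ y, u (y + ε • z) ∂ν' ∂(Phi d) := by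
    intro ν' _
    simp_rw [hsc]
    exact integral_prod_symm _ (hint ν')
  -- Rotation invariance, from c² + s² = 1.
  have e2 : ∫ z, u (c⁻¹ • z) ∂(Phi d) = ∫ z, B z ∂(Phi d) := by
    rw [← e1 (Phi d)]
    have hr := measurePreserving_rotate (d := d) hcs
    conv_lhs => rw [← hr.map_eq]
    rw [integral_map hr.measurable.aemeasurable
      (Measurable.aestronglyMeasurable (by fun_prop))]
  have hAi : Integrable A (Phi d) := (hint ν).integral_prod_right
  have hBi : Integrable B (Phi d) := (hint (Phi d)).integral_prod_right
  have hAB : ∫ z, (A z - B z) ∂(Phi d) ≤ η := by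
    have := (abs_le.1 (hη (fun x => u (c⁻¹ • x)) (by fun_prop) (fun _ => hu1 _))).2
    rw [e1 ν, e2] at this
    rw [integral_sub hAi hBi]
    exact this
  set X := ∫ x, h x ∂ν - ∫ x, h x ∂(Phi d) with hX
  have hall : ∀ z, -κ ≤ A z - B z := by
    intro z
    have := hκ _ (hH.affine_mem u huH 1 (ε • z))
    simp only [app_one] at this
    exact (abs_le.1 this).1
  have hosc : ∫ x, u2 x ∂(Phi d) ≤ ∫ x, h x ∂(Phi d) + 2 * a * δ := by
    have o := hH.oscillation (2 * δ) (by positivity) h hh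
    have hi2 : Integrable u2 (Phi d) := integrable_of_abs_le_one hu2m hu21
    have hlH := hH.lower_mem h hh (2 * δ) (by positivity)
    have hil : Integrable (lower h (2 * δ)) (Phi d) :=
      integrable_of_abs_le_one (hH.measurable _ hlH) (hH.bounded _ hlH)
    have hih : Integrable h (Phi d) := integrable_of_abs_le_one (hH.measurable h hh) h1
    rw [integral_sub hi2 hil] at o
    have := integral_mono hil hih (fun x => lower_le h1 (by positivity) x)
    linarith
  -- A shift by at most δ keeps u above h under ν and below the 2δ-envelope under Φ; (C3) bounds
  -- what the latter adds.
  have hball : ∀ z, ‖z‖ ≤ ρ → X - 2 * a * δ ≤ A z - B z := by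
    intro z hz
    have hεz : ‖ε • z‖ ≤ δ := by
      rw [norm_smul, Real.norm_eq_abs, abs_of_pos hε0]
      exact mul_le_mul_of_nonneg_left hz hε0.le
    have a1 : ∫ x, h x ∂ν ≤ A z := by
      refine integral_mono (integrable_of_abs_le_one (hH.measurable h hh) h1)
        (integrable_of_abs_le_one (by fun_prop) (fun _ => hu1 _)) (fun y => le_upper h1 ?_)
      rw [sub_add_cancel_left, norm_neg]
      exact hεz
    have a2 : B z ≤ ∫ x, u2 x ∂(Phi d) := by
      refine integral_mono (integrable_of_abs_le_one (by fun_prop) (fun _ => hu1 _))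
        (integrable_of_abs_le_one hu2m hu21) (fun y => upper_le_upper h1 hδ0.le ?_)
      rw [add_sub_cancel_left]
      exact hεz
    linarith
  -- If X ≤ 2aδ the claim is immediate. Otherwise X - 2aδ + κ ≥ 0, so the tail probability may be
  -- replaced by 1/4, giving ¾(X - 2aδ) - ¼κ ≤ η.
  rcases le_total (X - 2 * a * δ) 0 with hneg | hpos
  · have : 2 * a * ρ * ε = 2 * a * δ := by rw [hδ]; ring
    rw [this]
    linarith
  set p := (Phi d).real {z : Vec d | ρ < ‖z‖} with hp
  have hp4 : p ≤ 1 / 4 := measureReal_norm_gt_le hρ hd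
  have hms : MeasurableSet {z : Vec d | ρ < ‖z‖} :=
    measurableSet_lt measurable_const measurable_norm
  have hlow : (X - 2 * a * δ) - p * (X - 2 * a * δ + κ) ≤ ∫ z, (A z - B z) ∂(Phi d) := by
    have hi : Integrable (fun z => (X - 2 * a * δ) -
        Set.indicator {z : Vec d | ρ < ‖z‖} (fun _ => X - 2 * a * δ + κ) z) (Phi d) :=
      (integrable_const _).sub ((integrable_const _).indicator hms)
    have e : ∫ z, ((X - 2 * a * δ) -
        Set.indicator {z : Vec d | ρ < ‖z‖} (fun _ => X - 2 * a * δ + κ) z) ∂(Phi d) =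
        (X - 2 * a * δ) - p * (X - 2 * a * δ + κ) := by
      rw [integral_sub (integrable_const _) ((integrable_const _).indicator hms),
        integral_indicator_const _ hms]
      simp [hp]
    rw [← e]
    refine integral_mono hi (hAi.sub hBi) (fun z => ?_)
    by_cases hz : ρ < ‖z‖
    · have : z ∈ {z : Vec d | ρ < ‖z‖} := hz
      simp only [Set.indicator_of_mem this]
      linarith [hall z]
    · have : z ∉ {z : Vec d | ρ < ‖z‖} := hz
      simp only [Set.indicator_of_notMem this]
      linarith [hball z (not_lt.1 hz)]
  have : 2 * a * ρ * ε = 2 * a * δ := by rw [hδ]; ring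
  rw [this]
  have : p * (X - 2 * a * δ + κ) ≤ 1 / 4 * (X - 2 * a * δ + κ) :=
    mul_le_mul_of_nonneg_right hp4 (by linarith)
  linarith

/-- Smoothing inequality. -/
lemma IsTestClass.sSup_le_of_smoothed {H : Set (Vec d → ℝ)} {a : ℝ}
    (hH : IsTestClass H a) {ν : Measure (Vec d)} [IsProbabilityMeasure ν] {c s η κ ρ : ℝ}
    (hc : 0 < c) (hs : 0 < s) (hcs : c ^ 2 + s ^ 2 = 1)
    (hη : ∀ u : Vec d → ℝ, Measurable u → (∀ x, |u x| ≤ 1) →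
      |∫ p, u (c • p.1 + s • p.2) ∂(ν.prod (Phi d)) - ∫ z, u z ∂(Phi d)| ≤ η)
    (hκ : ∀ h ∈ H, |∫ x, h x ∂ν - ∫ x, h x ∂(Phi d)| ≤ κ)
    (hρ : 0 < ρ) (hd : 4 * d ≤ ρ ^ 2) {h : Vec d → ℝ} (hh : h ∈ H) :
    |∫ x, h x ∂ν - ∫ x, h x ∂(Phi d)| ≤ 2 * a * ρ * (s / c) + κ / 3 + 4 / 3 * η := by
  refine abs_le.2 ⟨?_, hH.integral_sub_le_of_smoothed hc hs hcs hη hκ hρ hd hh⟩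
  have := hH.neg.integral_sub_le_of_smoothed (h := fun x => -h x) (κ := κ) hc hs hcs hη
    (fun g hg => by
      have := hκ _ hg
      rw [integral_neg, integral_neg] at this
      rwa [← abs_neg, neg_sub, ← neg_sub_neg]) hρ hd (by simpa using hh)
  rw [integral_neg, integral_neg] at this
  linarith

end ExchPair

/-! ### The bound with a free parameter, and its two specializations. -/

namespace ExchPair

variable {d : ℕ}

variable (d) in
/-- A constant depending only on the dimension. -/
noncomputable def approxConst : ℝ := 6 * (2 * √d + 1) + 8 * momentBound d

lemma approxConst_pos : 0 < approxConst d := by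
  have := one_le_momentBound (d := d)
  have := Real.sqrt_nonneg (d : ℝ)
  rw [approxConst]
  linarith

lemma distance_nonneg {Ω : Type*} [MeasurableSpace Ω] {μ : Measure Ω} {H : Set (Vec d → ℝ)}
    {W : Ω → Vec d} {S : Mat d} : 0 ≤ distance μ H W S :=
  Real.sSup_nonneg (by rintro _ ⟨h, -, rfl⟩; exact abs_nonneg _)

section

variable {Ω : Type*} [MeasurableSpace Ω] {μ : Measure Ω} [IsProbabilityMeasure μ]
  {W W' R : Ω → Vec d} {S L : Mat d} {H : Set (Vec d → ℝ)} {a : ℝ}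

/-- The smoothing inequality is applied with the supremum over the class as κ, so that κ/3 can be
absorbed; finiteness of that supremum comes from |h| ≤ 1. -/
lemma IsSteinPair.abs_integral_sub_le (hW : IsSteinPair μ W W' R S L)
    (hf : FiniteTerms μ W W' S) (hH : IsTestClass H a) {t : ℝ} (ht : 0 < t) (ht1 : t ≤ 1)
    {h : Vec d → ℝ} (hh : h ∈ H) :
    |∫ x, h x ∂(μ.map (standardize S W)) - ∫ x, h x ∂(Phi d)| ≤
      approxConst d * (-(D' μ W W' R S L) * Real.log t + B' μ W W' S L / (2 * √t) + C' μ R S L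
        + a * √t) := by
  have hY := hW.isNormalizedPair
  have hm1 := one_le_momentBound (d := d)
  have hB0 := B'_nonneg μ W W' S L
  have hC0 := C'_nonneg μ R S L
  have hD0 := D'_nonneg μ W W' R S L
  have hd0 := Real.sqrt_nonneg (d : ℝ)
  have ha := hH.one_le
  set ν := μ.map (standardize S W) with hν
  have : IsProbabilityMeasure ν := Measure.isProbabilityMeasure_map hY.measurable_left.aemeasurable
  set m := momentBound d
  set D := D' μ W W' R S L
  set B := B' μ W W' S L
  set C := C' μ R S L
  set s := √t with hs
  have hs0 : 0 < s := Real.sqrt_pos.2 ht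
  have hs2 : s ^ 2 = t := Real.sq_sqrt ht.le
  have hlog : 0 ≤ -D * Real.log t := by
    have := Real.log_nonpos ht.le ht1
    nlinarith
  have hBs : 0 ≤ B / (2 * s) := by positivity
  have htriv : ∀ g ∈ H, |∫ x, g x ∂ν - ∫ x, g x ∂(Phi d)| ≤ 2 := by
    intro g hg
    have b : ∀ ν' : Measure (Vec d), [IsProbabilityMeasure ν'] → |∫ x, g x ∂ν'| ≤ 1 := by
      intro ν' _
      have := norm_integral_le_of_norm_le_const (μ := ν') (f := g)
        (ae_of_all _ fun x => hH.bounded g hg x)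
      simpa using this
    have := abs_sub (∫ x, g x ∂ν) (∫ x, g x ∂(Phi d))
    linarith [b ν, b (Phi d)]
  -- For t ≤ 1/2 the angle arcsin √t has cosine at least 1/2, so s/c ≤ 2s. For larger t the trivial
  -- bound 2 suffices, since a√t ≥ 1/2 and the constant is at least 8.
  rcases le_or_gt t (1 / 2) with ht2 | ht2
  · have hs1 : s ≤ 1 := by nlinarith
    have hsin : Real.sin (Real.arcsin s) = s := Real.sin_arcsin (by linarith) hs1
    have hcos : Real.cos (Real.arcsin s) = √(1 - t) := by rw [Real.cos_arcsin, hs2]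
    set c := √(1 - t) with hc
    have hc2 : c ^ 2 = 1 - t := Real.sq_sqrt (by linarith)
    have hc0 : 0 < c := Real.sqrt_pos.2 (by linarith)
    have hch : 1 / 2 ≤ c := by nlinarith
    set η := 2 * m * (-D * Real.log s + B / s + C) with hη
    have hη' : ∀ u : Vec d → ℝ, Measurable u → (∀ x, |u x| ≤ 1) →
        |∫ p, u (c • p.1 + s • p.2) ∂(ν.prod (Phi d)) - ∫ z, u z ∂(Phi d)| ≤ η := by
      intro u hu hu1
      have := hW.abs_integral_smoothed_sub_le hf hu hu1 (θ := Real.arcsin s)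
        (Real.arcsin_pos.2 hs0) (Real.arcsin_le_pi_div_two s)
      rwa [hsin, hcos] at this
    set Q := {r | ∃ g ∈ H, r = |∫ x, g x ∂ν - ∫ x, g x ∂(Phi d)|} with hQ
    have hQb : BddAbove Q := ⟨2, by rintro _ ⟨g, hg, rfl⟩; exact htriv g hg⟩
    have hκ : ∀ g ∈ H, |∫ x, g x ∂ν - ∫ x, g x ∂(Phi d)| ≤ sSup Q := fun g hg =>
      le_csSup hQb ⟨g, hg, rfl⟩
    -- Large enough that Z leaves the ball of radius ρ with probability at most 1/4; the summand 1
    -- makes 0 < ρ hold for every d.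
    set ρ := 2 * √(d : ℝ) + 1 with hρ
    have hρ0 : 0 < ρ := by positivity
    have hdρ : 4 * (d : ℝ) ≤ ρ ^ 2 := by
      have := Real.sq_sqrt (Nat.cast_nonneg (α := ℝ) d)
      nlinarith
    have hsup : sSup Q ≤ 2 * a * ρ * (s / c) + sSup Q / 3 + 4 / 3 * η := by
      refine csSup_le ⟨_, h, hh, rfl⟩ ?_
      rintro _ ⟨g, hg, rfl⟩
      exact hH.sSup_le_of_smoothed hc0 hs0 (by rw [hc2, hs2]; ring) hη' hκ hρ0 hdρ hg
    have hsc : s / c ≤ 2 * s := by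
      rw [div_le_iff₀ hc0]
      nlinarith
    have hsc' : a * ρ * (s / c) ≤ a * ρ * (2 * s) :=
      mul_le_mul_of_nonneg_left hsc (by positivity)
    have hls : Real.log s = Real.log t / 2 := by
      rw [hs, Real.log_sqrt ht.le]
    have hηe : 2 * η ≤ 8 * m * (-D * Real.log t + B / (2 * s) + C) := by
      have e : B / s = 2 * (B / (2 * s)) := by field_simp
      have e' : 2 * η = m * (2 * (-D * Real.log t) + 8 * (B / (2 * s)) + 4 * C) := by
        rw [hη, hls, e]
        ring
      rw [e', show ∀ x : ℝ, 8 * m * x = m * (8 * x) from fun x => by ring]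
      refine mul_le_mul_of_nonneg_left ?_ (by linarith)
      linarith
    have hfin : sSup Q ≤ 6 * ρ * (a * s) + 8 * m * (-D * Real.log t + B / (2 * s) + C) := by
      have : 6 * ρ * (a * s) = 3 * (a * ρ * (2 * s)) := by ring
      rw [this]
      linarith
    refine (hκ h hh).trans (hfin.trans ?_)
    have e1 : 0 ≤ 8 * m * (a * s) := by positivity
    have e2 : 0 ≤ 6 * ρ * (-D * Real.log t + B / (2 * s) + C) := by positivity
    rw [approxConst]
    linarith
  · refine (htriv h hh).trans ?_
    have hsh : 1 / 2 ≤ s := by nlinarith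
    have has : 1 / 2 ≤ a * s := by nlinarith
    have h8 : 8 ≤ approxConst d := by
      rw [approxConst]
      linarith
    calc (2 : ℝ) ≤ 8 * (1 / 2) := by norm_num
      _ ≤ approxConst d * (-D * Real.log t + B / (2 * s) + C + a * s) :=
        mul_le_mul h8 (by linarith) (by norm_num) (by linarith)

/-- The normal approximation bound with a free smoothing parameter `t`. -/
lemma IsSteinPair.distance_le (hW : IsSteinPair μ W W' R S L)
    (hf : FiniteTerms μ W W' S) (hH : IsTestClass H a) {t : ℝ} (ht : 0 < t) (ht1 : t ≤ 1) :
    distance μ H W S ≤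
      approxConst d * (-(D' μ W W' R S L) * Real.log t + B' μ W W' S L / (2 * √t) + C' μ R S L
        + a * √t) := by
  have hB0 := B'_nonneg μ W W' S L
  have hC0 := C'_nonneg μ R S L
  have hD0 := D'_nonneg μ W W' R S L
  have ha := hH.one_le
  have hlog : 0 ≤ -D' μ W W' R S L * Real.log t := by
    have := Real.log_nonpos ht.le ht1
    nlinarith
  refine Real.sSup_le ?_ (mul_nonneg approxConst_pos.le (by positivity))
  rintro _ ⟨h, hh, rfl⟩
  -- By (C2) the function x ↦ h(S^{1/2} x) is again in the class, which reduces the claim to the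
  -- standardized law.
  have hmem := hH.affine_mem h hh (CFC.sqrt S) 0
  simp only [add_zero] at hmem
  refine le_trans (le_of_eq ?_) (hW.abs_integral_sub_le hf hH ht ht1 hmem)
  rw [integral_map hW.isNormalizedPair.measurable_left.aemeasurable
    (hH.measurable _ hmem).aestronglyMeasurable]
  have : ∀ ω, app (CFC.sqrt S) (standardize S W ω) = W ω := fun ω => by
    rw [standardize, ← app_mul, sqrt_mul_inv_sqrt hW.posDef, app_one]
  simp_rw [this]

lemma IsSteinPair.distance_le_of_T' (hW : IsSteinPair μ W W' R S L)
    (hf : FiniteTerms μ W W' S) (hH : IsTestClass H a) (hT : T' μ W W' R S L a ≤ 1) :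
    distance μ H W S ≤
      approxConst d * (-(D' μ W W' R S L) * Real.log (T' μ W W' R S L a)
        + B' μ W W' S L / (2 * √(T' μ W W' R S L a)) + C' μ R S L
        + a * √(T' μ W W' R S L a)) := by
  have hT0 : 0 ≤ T' μ W W' R S L a := by rw [T']; positivity
  rcases hT0.lt_or_eq with hpos | hzero
  · exact hW.distance_le hf hH hpos hT
  have hB0 := B'_nonneg μ W W' S L
  have hD0 := D'_nonneg μ W W' R S L
  have ha := hH.one_le
  -- If T' = 0 then D' = B' = 0, and with the default values of log 0 and division by 0 only C'
  -- remains in the bracket. That bound is the limit t → 0 of the one with free t.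
  have hz : D' μ W W' R S L + √(a * B' μ W W' S L / 2 + D' μ W W' R S L ^ 2) = 0 := by
    have h1 : (1 / a ^ 2) ≠ 0 := by positivity
    rw [T'] at hzero
    exact (pow_eq_zero_iff two_ne_zero).1 ((mul_eq_zero.1 hzero.symm).resolve_left h1)
  have hs0 := Real.sqrt_nonneg (a * B' μ W W' S L / 2 + D' μ W W' R S L ^ 2)
  have hD : D' μ W W' R S L = 0 := by linarith
  have hB : B' μ W W' S L = 0 := by
    have h2 : √(a * B' μ W W' S L / 2 + D' μ W W' R S L ^ 2) = 0 := by linarith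
    rw [Real.sqrt_eq_zero (by positivity), hD] at h2
    have : a * B' μ W W' S L = 0 := by linarith
    exact (mul_eq_zero.1 this).resolve_left (by linarith)
  rw [← hzero, hD, hB]
  simp only [neg_zero, zero_mul, zero_div, zero_add, Real.sqrt_zero, mul_zero, add_zero]
  refine le_of_forall_pos_le_add fun ε hε => ?_
  have hK := approxConst_pos (d := d)
  set q := min 1 (ε / (approxConst d * a)) with hq
  have hq0 : 0 < q := lt_min one_pos (by positivity)
  have hq1 : q ≤ 1 := min_le_left _ _
  have := hW.distance_le hf hH (t := q ^ 2) (by positivity) (pow_le_one₀ hq0.le hq1)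
  rw [hD, hB, Real.sqrt_sq hq0.le] at this
  simp only [neg_zero, zero_mul, zero_div, zero_add] at this
  refine this.trans ?_
  rw [mul_add]
  gcongr
  have h3 : q ≤ ε / (approxConst d * a) := min_le_right _ _
  rw [le_div_iff₀ (by positivity)] at h3
  linarith

end

/-- The rate of convergence for terms of order `n ^ (-1 / 2)`. -/
lemma isBigO_distance {H : Set (Vec d → ℝ)} {a : ℝ} (hH : IsTestClass H a)
    {Ω : ℕ → Type*} [∀ n, MeasurableSpace (Ω n)] {μ : ∀ n, Measure (Ω n)}
    [∀ n, IsProbabilityMeasure (μ n)] {W W' R : ∀ n, Ω n → Vec d} {S L : ℕ → Mat d}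
    (hW : ∀ n, IsSteinPair (μ n) (W n) (W' n) (R n) (S n) (L n))
    (hf : ∀ n, FiniteTerms (μ n) (W n) (W' n) (S n))
    (hA : (fun n => A' (μ n) (W n) (W' n) (S n) (L n))
      =O[atTop] (fun n => (n : ℝ) ^ (-(1 / 2) : ℝ)))
    (hB : (fun n => B' (μ n) (W n) (W' n) (S n) (L n))
      =O[atTop] (fun n => (n : ℝ) ^ (-(1 / 2) : ℝ)))
    (hC : (fun n => C' (μ n) (R n) (S n) (L n))
      =O[atTop] (fun n => (n : ℝ) ^ (-(1 / 2) : ℝ))) :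
    (fun n => distance (μ n) H (W n) (S n)) =O[atTop] (fun n => (n : ℝ) ^ (-(1 / 4) : ℝ)) := by
  have hD : (fun n => D' (μ n) (W n) (W' n) (R n) (S n) (L n))
      =O[atTop] (fun n => (n : ℝ) ^ (-(1 / 2) : ℝ)) := by
    have h1 := (hA.const_mul_left (1 / 2)).add (hC.const_mul_left (d : ℝ))
    refine h1.congr_left fun n => ?_
    rw [D']
    ring
  have hmul : (fun n : ℕ => (n : ℝ) ^ (-(1 / 2) : ℝ) * (n : ℝ) ^ (1 / 4 : ℝ))
      =ᶠ[atTop] (fun n => (n : ℝ) ^ (-(1 / 4) : ℝ)) := by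
    filter_upwards [eventually_gt_atTop 0] with n hn
    rw [← Real.rpow_add (by exact_mod_cast hn)]
    norm_num
  have hlog : (fun n : ℕ => Real.log ((n : ℝ) ^ (-(1 / 2) : ℝ)))
      =O[atTop] (fun n => (n : ℝ) ^ (1 / 4 : ℝ)) := by
    have h1 := ((isLittleO_log_rpow_atTop (r := 1 / 4) (by norm_num)).isBigO.comp_tendsto
      tendsto_natCast_atTop_atTop).const_mul_left (-(1 / 2))
    refine h1.congr' ?_ EventuallyEq.rfl
    filter_upwards [eventually_gt_atTop 0] with n hn
    rw [Real.log_rpow (by exact_mod_cast hn)]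
    rfl
  have hsqrt : ∀ n : ℕ, √((n : ℝ) ^ (-(1 / 2) : ℝ)) = (n : ℝ) ^ (-(1 / 4) : ℝ) := by
    intro n
    rw [Real.sqrt_eq_rpow, ← Real.rpow_mul (Nat.cast_nonneg n)]
    norm_num
  have t1 : (fun n => -(D' (μ n) (W n) (W' n) (R n) (S n) (L n))
      * Real.log ((n : ℝ) ^ (-(1 / 2) : ℝ))) =O[atTop] (fun n => (n : ℝ) ^ (-(1 / 4) : ℝ)) :=
    (hD.neg_left.mul hlog).congr' EventuallyEq.rfl hmul
  have t2 : (fun n => B' (μ n) (W n) (W' n) (S n) (L n) / (2 * √((n : ℝ) ^ (-(1 / 2) : ℝ))))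
      =O[atTop] (fun n => (n : ℝ) ^ (-(1 / 4) : ℝ)) := by
    have h1 := ((hB.mul (isBigO_refl (fun n : ℕ => (n : ℝ) ^ (1 / 4 : ℝ)) atTop)).const_mul_left
      (1 / 2)).congr' EventuallyEq.rfl hmul
    refine h1.congr_left fun n => ?_
    rw [hsqrt, Real.rpow_neg (Nat.cast_nonneg n)]
    field_simp
  have t3 : (fun n => C' (μ n) (R n) (S n) (L n)) =O[atTop]
      (fun n => (n : ℝ) ^ (-(1 / 4) : ℝ)) := by
    refine hC.trans (IsBigO.of_bound' ?_)
    filter_upwards [eventually_ge_atTop 1] with n hn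
    have hn' : (1 : ℝ) ≤ n := by exact_mod_cast hn
    rw [Real.norm_of_nonneg (by positivity), Real.norm_of_nonneg (by positivity)]
    exact Real.rpow_le_rpow_of_exponent_le hn' (by norm_num)
  have t4 : (fun n : ℕ => a * √((n : ℝ) ^ (-(1 / 2) : ℝ)))
      =O[atTop] (fun n => (n : ℝ) ^ (-(1 / 4) : ℝ)) := by
    simp_rw [hsqrt]
    exact (isBigO_refl _ _).const_mul_left a
  -- The parameter is t = n^{-1/2} rather than T', so T' ≤ 1 need not be checked. The terms B'/√t
  -- and a√t are both of order n^{-1/4}, and the logarithm next to D' is absorbed by n^{1/4}.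
  refine IsBigO.trans (IsBigO.of_bound' ?_) ((((t1.add t2).add t3).add t4).const_mul_left
    (approxConst d))
  filter_upwards [eventually_ge_atTop 1] with n hn
  have hn' : (1 : ℝ) ≤ n := by exact_mod_cast hn
  rw [Real.norm_of_nonneg distance_nonneg]
  exact ((hW n).distance_le (hf n) hH (Real.rpow_pos_of_pos (by linarith) _)
    (Real.rpow_le_one_of_one_le_of_nonpos hn' (by norm_num))).trans (Real.le_norm_self _)

end ExchPair

theorem corollary3p1 (d : ℕ) :
    (∃ γ : ℝ, 0 < γ ∧
      ∀ (H : Set (ExchPair.Vec d → ℝ)) (a : ℝ), ExchPair.IsTestClass H a →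
      ∀ (Ω : Type*) [MeasurableSpace Ω] (μ : Measure Ω) [IsProbabilityMeasure μ]
        (W W' R : Ω → ExchPair.Vec d) (S L : ExchPair.Mat d),
        ExchPair.IsSteinPair μ W W' R S L →
        ExchPair.FiniteTerms μ W W' S →
        ExchPair.T' μ W W' R S L a ≤ 1 →
        ExchPair.distance μ H W S ≤
          γ ^ 2 * (-(ExchPair.D' μ W W' R S L) * Real.log (ExchPair.T' μ W W' R S L a)
            + ExchPair.B' μ W W' S L / (2 * √(ExchPair.T' μ W W' R S L a))
            + ExchPair.C' μ R S L
            + a * √(ExchPair.T' μ W W' R S L a))) ∧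
    (∀ (H : Set (ExchPair.Vec d → ℝ)) (a : ℝ), ExchPair.IsTestClass H a →
      ∀ (Ω : ℕ → Type*) [∀ n, MeasurableSpace (Ω n)] (μ : ∀ n, Measure (Ω n))
        [∀ n, IsProbabilityMeasure (μ n)]
        (W W' R : ∀ n, Ω n → ExchPair.Vec d) (S L : ℕ → ExchPair.Mat d),
        (∀ n, ExchPair.IsSteinPair (μ n) (W n) (W' n) (R n) (S n) (L n)) →
        (∀ n, ExchPair.FiniteTerms (μ n) (W n) (W' n) (S n)) →
        (fun n => ExchPair.A' (μ n) (W n) (W' n) (S n) (L n))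
          =O[atTop] (fun n => (n : ℝ) ^ (-(1 / 2) : ℝ)) →
        (fun n => ExchPair.B' (μ n) (W n) (W' n) (S n) (L n))
          =O[atTop] (fun n => (n : ℝ) ^ (-(1 / 2) : ℝ)) →
        (fun n => ExchPair.C' (μ n) (R n) (S n) (L n))
          =O[atTop] (fun n => (n : ℝ) ^ (-(1 / 2) : ℝ)) →
        (fun n => ExchPair.distance (μ n) H (W n) (S n))
          =O[atTop] (fun n => (n : ℝ) ^ (-(1 / 4) : ℝ))) := by
  -- The square root is taken because the statement has γ² as its constant.
  refine ⟨⟨√(ExchPair.approxConst d), Real.sqrt_pos.2 ExchPair.approxConst_pos, ?_⟩, ?_⟩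
  · intro H a hH Ω _ μ _ W W' R S L hW hf hT
    rw [Real.sq_sqrt ExchPair.approxConst_pos.le]
    exact hW.distance_le_of_T' hf hH hT
  · intro H a hH Ω _ μ _ W W' R S L hW hf hA hB hC
    exact ExchPair.isBigO_distance hH hW hf hA hB hC
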